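/- **Setting.** There are $N$ actions and $T\ge 1$ rounds. An oblivious adversary fixes loss vectors $g_1,\dots,g_T\in[-1,0]^N$ (negative gains). In round $t$ the learner plays $i_t\in[N]$ and observes only $g_{t,i_t}$. The regret is $\mathrm{Regret}_T=\max_{i\in[N]}\sum_{t=1}^T (g_{t,i}-g_{t,i_t})$. **Algorithm** (Follow the Perturbed Leader with Geometric Resampling, with perturbation law $\mathcal D$ on $\mathbb R$, scale $\eta>0$ and truncation level $M\in\mathbb N$). Let $Z_t^{(k)}\in\mathbb R^N$, $t\ge 1$, $k\ge 0$, be random vectors all of whose coordinates are independent with law $\mathcal D$. Put $\hat G_0=0$. In round $t$ play $i_t=\arg\max_j\{\hat G_{t-1,j}+\eta Z^{(0)}_{t,j}\}$, let $$K_t=\min\Big(\big\{k\ge 1:\ \arg\max_j\{\hat G_{t-1,j}+\eta Z^{(k)}_{t,j}\}=i_t\big\}\cup\{M\}\Big),$$ and set $\hat G_t=\hat G_{t-1}+g_{t,i_t}K_t\,e_{i_t}$. Ties in the $\arg\max$ are broken by an arbitrary measurable rule. For a law $\mathcal D$, let its conditioned version be the law of $X-1$ given $X>1$, where $X\sim\mathcal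 D$. **Corollary.** Let $M\ge\lfloor\sqrt{NT}\rfloor$ be an integer (in particular $M$ may be $\sqrt{NT}$ rounded up or down). In each of the following cases there is a constant $C$, depending on nothing except, in case 5, on $\alpha$, such that for every loss sequence $$\mathbb E\,[\mathrm{Regret}_T]\le C\sqrt{TN\log N}.$$ 1. $\mathcal D$ is the Gumbel distribution with any location $\mu\in\mathbb R$ and scale $1$; $\eta=\sqrt{NT/\log N}$; $N\ge 2$. 2. $\mathcal D$ is the Fréchet distribution with CDF $\exp(-x^{-\alpha})$ on $x>0$, $\alpha=\log N$; $\eta=\sqrt{NT\log N}$; $N\ge 3$ (so that $\alpha>1$). 3. $\mathcal D$ is the conditioned version of the Weibull distribution with scale $1$ and shape $k=1$ (it is the exponential distribution of rate 1); $\eta=\sqrt{NT/\log N}$; $N\ge 2$. 4. $\mathcal D$ is the conditioned version of the Pareto distribution with scale $x_m=1$ and shape $\alpha=\log N$, with CDF $1-(1+x)^{-\alpha}$ on $x>0$; $\eta=\sqrt{NT\log N}$; $N\ge 3$. 5. $\mathcal D$ is the Gamma distribution with shape $\alpha\ge 1$ and rate $\beta>0$ (the case $\alpha=\beta=1$ being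 the exponential distribution); $\eta=\beta\sqrt{NT/\log N}$; $N\ge 2$. -/

import Mathlib

open MeasureTheory ProbabilityTheory Set Filter
open scoped Topology ENNReal

namespace FTPL

/-! ### Perturbation distributions -/

/-- Density of the Gumbel distribution with location `μ` and scale `β`. -/
noncomputable def gumbelPDFReal (μ β x : ℝ) : ℝ :=
  β⁻¹ * Real.exp (-((x - μ) / β)) * Real.exp (-Real.exp (-((x - μ) / β)))

/-- The Gumbel distribution with location `μ` and scale `β`. -/
noncomputable def gumbelMeasure (μ β : ℝ) : Measure ℝ :=
  volume.withDensity fun x => ENNReal.ofReal (gumbelPDFReal μ β x)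

/-- Density of the Fréchet distribution with shape `α` (location `0`, scale `1`). -/
noncomputable def frechetPDFReal (α x : ℝ) : ℝ :=
  if 0 < x then α * x ^ (-α - 1) * Real.exp (-x ^ (-α)) else 0

/-- The Fréchet distribution with shape `α` (location `0`, scale `1`). -/
noncomputable def frechetMeasure (α : ℝ) : Measure ℝ :=
  volume.withDensity fun x => ENNReal.ofReal (frechetPDFReal α x)

/-- Density of the Weibull distribution with scale `l` and shape `k`. -/
noncomputable def weibullPDFReal (l k x : ℝ) : ℝ :=
  if 0 < x then k / l * (x / l) ^ (k - 1) * Real.exp (-(x / l) ^ k) else 0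

/-- The Weibull distribution with scale `l` and shape `k`. -/
noncomputable def weibullMeasure (l k : ℝ) : Measure ℝ :=
  volume.withDensity fun x => ENNReal.ofReal (weibullPDFReal l k x)

/-- The conditioning trick: the law of `X - 1` conditionally on `X > 1`, where `X` has law `D`. -/
noncomputable def conditioned (D : Measure ℝ) : Measure ℝ :=
  (ProbabilityTheory.cond D (Ioi 1)).map fun x => x - 1

/-! The laws above are probability measures. -/

theorem isProb_of_cdf (f F : ℝ → ℝ) (hf : ∀ x, 0 < x → 0 ≤ f x)
    (h0 : ∀ x, x ≤ 0 → f x = 0) (hF0 : Tendsto F (𝓝[>] 0) (𝓝 0))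
    (hd : ∀ x, 0 < x → HasDerivAt F (f x) x) (ht : Tendsto F atTop (𝓝 1)) :
    IsProbabilityMeasure (volume.withDensity fun x => ENNReal.ofReal (f x)) := by
  have hG : ∀ x ∈ Ioi (0:ℝ), HasDerivAt (Function.update F 0 0) (f x) x := fun x hx => by
    refine (hd x hx).congr_of_eventuallyEq ?_
    filter_upwards [lt_mem_nhds hx] with y hy
    exact Function.update_of_ne (ne_of_gt hy) _ _
  have hc : ContinuousWithinAt (Function.update F 0 0) (Ici 0) 0 := by
    rw [continuousWithinAt_update_same]
    simpa using hF0
  have htt : Tendsto (Function.update F 0 0) atTop (𝓝 1) := by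
    refine ht.congr' ?_
    filter_upwards [eventually_gt_atTop 0] with y hy
    exact (Function.update_of_ne (ne_of_gt hy) _ _).symm
  have hi := integrableOn_Ioi_deriv_of_nonneg hc hG hf htt
  have he := integral_Ioi_of_hasDerivAt_of_nonneg hc hG hf htt
  refine ⟨?_⟩
  rw [withDensity_apply _ MeasurableSet.univ, setLIntegral_univ]
  have : ∫⁻ x, ENNReal.ofReal (f x) = ∫⁻ x in Ioi 0, ENNReal.ofReal (f x) := by
    rw [← lintegral_indicator measurableSet_Ioi]
    congr 1; ext x
    by_cases hx : 0 < x
    · simp [hx]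
    · simp [hx, h0 x (not_lt.mp hx)]
  rw [this, ← ofReal_integral_eq_lintegral_ofReal hi]
  · rw [he]; simp
  · exact (ae_restrict_iff' measurableSet_Ioi).2 (ae_of_all _ hf)

theorem isProbabilityMeasure_frechetMeasure {α : ℝ} (hα : 0 < α) :
    IsProbabilityMeasure (frechetMeasure α) := by
  refine isProb_of_cdf _ (fun x => Real.exp (-x ^ (-α))) (fun x hx => ?_) (fun x hx => ?_) ?_
    (fun x hx => ?_) ?_
  · rw [frechetPDFReal, if_pos hx]; positivity
  · rw [frechetPDFReal, if_neg (not_lt.2 hx)]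
  · exact Real.tendsto_exp_neg_atTop_nhds_zero.comp (tendsto_rpow_neg_nhdsGT_zero (neg_lt_zero.2 hα))
  · rw [frechetPDFReal, if_pos hx]
    have h := ((Real.hasDerivAt_rpow_const (p := -α) (Or.inl hx.ne')).fun_neg).exp
    convert h using 1
    ring
  · have := (tendsto_rpow_neg_atTop hα).neg
    have h2 := (Real.continuous_exp.tendsto _).comp this
    simpa [Function.comp_def] using h2

theorem isProbabilityMeasure_weibullMeasure {l k : ℝ} (hl : 0 < l) (hk : 0 < k) :
    IsProbabilityMeasure (weibullMeasure l k) := by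
  refine isProb_of_cdf _ (fun x => 1 - Real.exp (-(x / l) ^ k)) (fun x hx => ?_) (fun x hx => ?_)
    ?_ (fun x hx => ?_) ?_
  · rw [weibullPDFReal, if_pos hx]; positivity
  · rw [weibullPDFReal, if_neg (not_lt.2 hx)]
  · have : Continuous fun x : ℝ => 1 - Real.exp (-(x / l) ^ k) := by
      have := Real.continuous_rpow_const hk.le
      fun_prop
    have h := (this.tendsto 0).mono_left (nhdsWithin_le_nhds (s := Ioi 0))
    simpa [Real.zero_rpow hk.ne'] using h
  · rw [weibullPDFReal, if_pos hx]
    have h1 : HasDerivAt (fun x : ℝ => x / l) (1 / l) x := (hasDerivAt_id x).div_const l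
    have h2 := ((h1.rpow_const (p := k) (Or.inl (div_pos hx hl).ne')).fun_neg.exp).const_sub 1
    refine h2.congr_deriv ?_
    ring
  · have h1 : Tendsto (fun x : ℝ => (x / l) ^ k) atTop atTop :=
      (tendsto_rpow_atTop hk).comp (tendsto_id.atTop_div_const hl)
    have h2 := (Real.tendsto_exp_neg_atTop_nhds_zero.comp h1).const_sub 1
    simpa using h2

theorem isProbabilityMeasure_gumbelMeasure (μ : ℝ) {β : ℝ} (hβ : 0 < β) :
    IsProbabilityMeasure (gumbelMeasure μ β) := by
  have hd : ∀ x, HasDerivAt (fun x => Real.exp (-Real.exp (-((x - μ) / β))))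
      (gumbelPDFReal μ β x) x := fun x => by
    have h1 : HasDerivAt (fun x : ℝ => (x - μ) / β) (1 / β) x :=
      ((hasDerivAt_id x).sub_const μ).div_const β
    convert (h1.fun_neg.exp.fun_neg).exp using 1
    simp only [gumbelPDFReal]; ring
  have h0 : ∀ x, 0 ≤ gumbelPDFReal μ β x := fun x => by rw [gumbelPDFReal]; positivity
  have ha : Tendsto (fun x : ℝ => (x - μ) / β) atTop atTop :=
    (tendsto_atTop_add_const_right _ (-μ) tendsto_id).atTop_div_const hβ
  have hb : Tendsto (fun x : ℝ => (x - μ) / β) atBot atBot :=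
    (tendsto_atBot_add_const_right _ (-μ) tendsto_id).atBot_div_const hβ
  have hT : Tendsto (fun x => Real.exp (-Real.exp (-((x - μ) / β)))) atTop (𝓝 1) := by
    have := (Real.continuous_exp.tendsto _).comp (Real.tendsto_exp_neg_atTop_nhds_zero.comp ha).neg
    simpa [Function.comp_def] using this
  have hB : Tendsto (fun x => Real.exp (-Real.exp (-((x - μ) / β)))) atBot (𝓝 0) :=
    Real.tendsto_exp_neg_atTop_nhds_zero.comp
      (Real.tendsto_exp_atTop.comp (tendsto_neg_atBot_atTop.comp hb))
  have hi : Integrable (gumbelPDFReal μ β) := by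
    rw [← integrableOn_univ, ← Iic_union_Ioi (a := (0 : ℝ))]
    refine IntegrableOn.union ?_ (integrableOn_Ioi_deriv_of_nonneg' (fun x _ => hd x)
      (fun x _ => h0 x) hT)
    have hn : ∀ x ∈ Ici (0 : ℝ), HasDerivAt
        (fun x => -Real.exp (-Real.exp (-((-x - μ) / β)))) (gumbelPDFReal μ β (-x)) x := by
      intro x _
      simpa using ((hd (-x)).comp x (hasDerivAt_neg x)).fun_neg
    have h2 := integrableOn_Ioi_deriv_of_nonneg' hn (fun x _ => h0 (-x))
      (hB.comp tendsto_neg_atTop_atBot).neg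
    rw [← neg_zero] at h2
    exact (integrableOn_Iic_iff_integrableOn_Iio (by simp)).2 (by simpa using h2.comp_neg_Iio)
  refine ⟨?_⟩
  rw [gumbelMeasure, withDensity_apply _ MeasurableSet.univ, setLIntegral_univ,
    ← ofReal_integral_eq_lintegral_ofReal hi (ae_of_all _ h0),
    integral_of_hasDerivAt_of_tendsto hd hi hB hT]
  simp

theorem isProbabilityMeasure_conditioned {D : Measure ℝ} [IsProbabilityMeasure D]
    (h : D (Ioi 1) ≠ 0) : IsProbabilityMeasure (conditioned D) := by
  have := ProbabilityTheory.cond_isProbabilityMeasure (μ := D) h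
  exact Measure.isProbabilityMeasure_map (by fun_prop)

/-! ### Follow the Perturbed Leader with Geometric Resampling

The losses are `g t i ∈ [-1, 0]` for round `t` (numbered from `0`) and action `i`.  A realization
of the learner's randomness is an array `z`: `z t 0` is the perturbation vector used to play in
round `t`, and `z t k`, `k ≥ 1`, are the perturbation vectors drawn in that round by the
resampling procedure. -/

variable {N : ℕ}

/-- `sel` returns a coordinate at which a vector is maximal; ties are broken arbitrarily (but
measurably). -/
def IsLeaderRule (sel : (Fin N → ℝ) → Fin N) : Prop :=
  Measurable sel ∧ ∀ (x : Fin N → ℝ) (j : Fin N), x j ≤ x (sel x)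

/-- The perturbed leader: a maximizer of `G j + η * v j`. -/
def leader (sel : (Fin N → ℝ) → Fin N) (η : ℝ) (G v : Fin N → ℝ) : Fin N :=
  sel fun j => G j + η * v j

/-- Geometric Resampling truncated at `M`: the first `k ≥ 1` such that the perturbed leader
computed from the fresh perturbation `w k` is again the action `i`, or `M` if there is no such
`k` up to `M`. -/
noncomputable def resampleCount (sel : (Fin N → ℝ) → Fin N) (η : ℝ) (M : ℕ) (G : Fin N → ℝ)
    (i : Fin N) (w : ℕ → Fin N → ℝ) : ℕ :=
  sInf ({k | 1 ≤ k ∧ leader sel η G (w k) = i} ∪ {M})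

/-- The estimate of the cumulative loss vector after `t` rounds.  In round `t` the action
`i = leader sel η (cumEstimate t) (z t 0)` is played, only the loss `g t i` is observed, and
`g t i * K` is added to the `i`-th coordinate, where `K` is the resampling count. -/
noncomputable def cumEstimate (sel : (Fin N → ℝ) → Fin N) (η : ℝ) (M : ℕ) (g : ℕ → Fin N → ℝ)
    (z : ℕ → ℕ → Fin N → ℝ) : ℕ → Fin N → ℝ
  | 0 => 0
  | t + 1 =>
    let G := cumEstimate sel η M g z t
    let i := leader sel η G (z t 0)
    G + Pi.single i (g t i * (resampleCount sel η M G i (z t) : ℝ))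

/-- The action played in round `t`. -/
noncomputable def action (sel : (Fin N → ℝ) → Fin N) (η : ℝ) (M : ℕ) (g : ℕ → Fin N → ℝ)
    (z : ℕ → ℕ → Fin N → ℝ) (t : ℕ) : Fin N :=
  leader sel η (cumEstimate sel η M g z t) (z t 0)

/-- The regret after `T` rounds against the best fixed action in hindsight. -/
noncomputable def regret (sel : (Fin N → ℝ) → Fin N) (η : ℝ) (M : ℕ) (g : ℕ → Fin N → ℝ)
    (T : ℕ) (z : ℕ → ℕ → Fin N → ℝ) : ℝ :=
  ⨆ i : Fin N, ∑ t ∈ Finset.range T, (g t i - g t (action sel η M g z t))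

/-- All the coordinates of the random array `Z` are independent with law `D`. -/
def IsIID {Ω : Type*} [MeasurableSpace Ω] (P : Measure Ω) (D : Measure ℝ)
    (Z : Ω → ℕ → ℕ → Fin N → ℝ) : Prop :=
  (∀ t k j, Measurable fun ω => Z ω t k j) ∧
  (∀ t k j, P.map (fun ω => Z ω t k j) = D) ∧
  iIndepFun (fun (q : ℕ × ℕ × Fin N) ω => Z ω q.1 q.2.1 q.2.2) P

/-- With `N` actions, horizon `T`, perturbations `η * Z` where `Z` has i.i.d. coordinates of law
`D`, and resampling truncated at `M`, the expected regret of Follow the Perturbed Leader is at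
most `B` for every sequence of losses in `[-1, 0]`. -/
def ExpectedRegretAtMost.{u} (D : Measure ℝ) (η : ℝ) (N T M : ℕ) (B : ℝ) : Prop :=
  ∀ (Ω : Type u) [MeasurableSpace Ω] (P : Measure Ω) [IsProbabilityMeasure P]
    (Z : Ω → ℕ → ℕ → Fin N → ℝ), IsIID P D Z →
  ∀ sel : (Fin N → ℝ) → Fin N, IsLeaderRule sel →
  ∀ g : ℕ → Fin N → ℝ, (∀ t i, g t i ∈ Icc (-1 : ℝ) 0) →
    Integrable (fun ω => regret sel η M g T (Z ω)) P ∧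
      ∫ ω, regret sel η M g T (Z ω) ∂P ≤ B

end FTPL

namespace FTPL

variable {N : ℕ}

/-- The probability that the perturbed leader for the cumulative gains `G` is the action `i`. -/
noncomputable def playProb (sel : (Fin N → ℝ) → Fin N) (η : ℝ) (D : Measure ℝ) (G : Fin N → ℝ)
    (i : Fin N) : ℝ :=
  (Measure.pi fun _ : Fin N => D).real {v | leader sel η G v = i}

/-- The stochastically smoothed maximum. -/
noncomputable def potential (η : ℝ) (D : Measure ℝ) (G : Fin N → ℝ) : ℝ :=
  ∫ v, (⨆ j, (G j + η * v j)) ∂Measure.pi fun _ : Fin N => D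

/-- A form of the condition that the hazard rate of `D` is at most `H` which mentions no
density. -/
def HazardRateLE (D : Measure ℝ) (H : ℝ) : Prop :=
  ∀ x δ : ℝ, 0 ≤ δ → ENNReal.ofReal (1 - H * δ) * D (Ici x) ≤ D (Ioi (x + δ))

theorem measurable_leader {sel : (Fin N → ℝ) → Fin N} (hsel : IsLeaderRule sel) (η : ℝ) :
    Measurable fun q : (Fin N → ℝ) × (Fin N → ℝ) => leader sel η q.1 q.2 := by
  have : Measurable fun q : (Fin N → ℝ) × (Fin N → ℝ) => fun j => q.1 j + η * q.2 j := by
    fun_prop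
  exact hsel.1.comp this

theorem measurable_leader_right {sel : (Fin N → ℝ) → Fin N} (hsel : IsLeaderRule sel) (η : ℝ)
    (G : Fin N → ℝ) : Measurable (leader sel η G) :=
  (measurable_leader hsel η).comp measurable_prodMk_left

theorem measurableSet_leader_eq {sel : (Fin N → ℝ) → Fin N} (hsel : IsLeaderRule sel) (η : ℝ)
    (G : Fin N → ℝ) (i : Fin N) : MeasurableSet {v | leader sel η G v = i} :=
  measurable_leader_right hsel η G (measurableSet_singleton i)

theorem HazardRateLE.forall_le {D : Measure ℝ} [IsProbabilityMeasure D] {H δ : ℝ}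
    (hD : HazardRateLE D H) (hH : 0 ≤ H) (hδ : 0 ≤ δ) {ι : Type*} [Finite ι] (a : ι → ℝ) :
    ENNReal.ofReal (1 - H * δ) * D {x | ∀ j, a j ≤ x} ≤ D {x | ∀ j, a j + δ < x} := by
  cases isEmpty_or_nonempty ι with
  | inl h =>
    have h1 : 1 - H * δ ≤ 1 := by nlinarith
    simpa using h1
  | inr h =>
    obtain ⟨k, hk⟩ := Finite.exists_max a
    refine le_trans (le_trans ?_ (hD (a k) δ hδ)) ?_
    · gcongr
      exact fun x hx => hx k
    · exact measure_mono fun x (hx : a k + δ < x) j => by have := hk j; linarith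

theorem one_sub_mul_pi_le {D : Measure ℝ} [IsProbabilityMeasure D] {H δ : ℝ}
    (hD : HazardRateLE D H) (hH : 0 ≤ H) (hδ : 0 ≤ δ) (a : Fin N → ℝ) (i : Fin N) :
    ENNReal.ofReal (1 - H * δ) *
        (Measure.pi fun _ : Fin N => D) {v | ∀ j, j ≠ i → a j + v j ≤ v i} ≤
      (Measure.pi fun _ : Fin N => D) {v | ∀ j, j ≠ i → a j + v j + δ < v i} := by
  obtain _ | n := N
  · exact i.elim0
  have hmp := measurePreserving_piFinSuccAbove (fun _ : Fin (n + 1) => D) i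
  have hA : MeasurableSet {q : ℝ × (Fin n → ℝ) | ∀ j, a (i.succAbove j) + q.2 j ≤ q.1} := by
    rw [ofPred_forall]
    exact MeasurableSet.iInter fun j => measurableSet_le (by fun_prop) (by fun_prop)
  have hB : MeasurableSet {q : ℝ × (Fin n → ℝ) | ∀ j, a (i.succAbove j) + q.2 j + δ < q.1} := by
    rw [ofPred_forall]
    exact MeasurableSet.iInter fun j => measurableSet_lt (by fun_prop) (by fun_prop)
  have eA := hmp.measure_preimage hA.nullMeasurableSet
  have eB := hmp.measure_preimage hB.nullMeasurableSet
  have sA : (MeasurableEquiv.piFinSuccAbove (fun _ : Fin (n + 1) => ℝ) i) ⁻¹'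
      {q : ℝ × (Fin n → ℝ) | ∀ j, a (i.succAbove j) + q.2 j ≤ q.1} =
      {v | ∀ j, j ≠ i → a j + v j ≤ v i} := by
    ext v
    simp only [mem_preimage, mem_ofPred_eq, Fin.forall_iff_succAbove i, ne_eq, not_true_eq_false,
      false_imp_iff, true_and, Fin.succAbove_ne, not_false_eq_true, true_imp_iff]
    rfl
  have sB : (MeasurableEquiv.piFinSuccAbove (fun _ : Fin (n + 1) => ℝ) i) ⁻¹'
      {q : ℝ × (Fin n → ℝ) | ∀ j, a (i.succAbove j) + q.2 j + δ < q.1} =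
      {v | ∀ j, j ≠ i → a j + v j + δ < v i} := by
    ext v
    simp only [mem_preimage, mem_ofPred_eq, Fin.forall_iff_succAbove i, ne_eq, not_true_eq_false,
      false_imp_iff, true_and, Fin.succAbove_ne, not_false_eq_true, true_imp_iff]
    rfl
  rw [← sA, ← sB, eA, eB, Measure.prod_apply_symm hA, Measure.prod_apply_symm hB,
    ← lintegral_const_mul _ (measurable_measure_prodMk_right hA)]
  exact lintegral_mono fun y => hD.forall_le hH hδ fun j => a (i.succAbove j) + y j

theorem playProb_nonneg (sel : (Fin N → ℝ) → Fin N) (η : ℝ) (D : Measure ℝ) (G : Fin N → ℝ)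
    (i : Fin N) : 0 ≤ playProb sel η D G i := measureReal_nonneg

theorem playProb_le_one (sel : (Fin N → ℝ) → Fin N) (η : ℝ) (D : Measure ℝ)
    [IsProbabilityMeasure D] (G : Fin N → ℝ) (i : Fin N) : playProb sel η D G i ≤ 1 :=
  measureReal_le_one

/-- Decreasing the `i`-th cumulative gain by `-a` decreases the probability of `i` by a factor
which is at least `1 + H * (a / η)`. -/
theorem le_playProb_add_single {sel : (Fin N → ℝ) → Fin N} (hsel : IsLeaderRule sel) {η H : ℝ}
    (hη : 0 < η) (hH : 0 ≤ H) {D : Measure ℝ} [IsProbabilityMeasure D] (hD : HazardRateLE D H)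
    (G : Fin N → ℝ) (i : Fin N) {a : ℝ} (ha : a ≤ 0) :
    (1 + H * (a / η)) * playProb sel η D G i ≤ playProb sel η D (G + Pi.single i a) i := by
  have hδ : 0 ≤ -a / η := div_nonneg (by linarith) hη.le
  have key := one_sub_mul_pi_le hD hH hδ (fun j => (G j - G i) / η) i
  have key2 : ENNReal.ofReal (1 - H * (-a / η)) *
      (Measure.pi fun _ : Fin N => D) {v | leader sel η G v = i} ≤
      (Measure.pi fun _ : Fin N => D) {v | leader sel η (G + Pi.single i a) v = i} := by
    refine le_trans (le_trans ?_ key) (measure_mono ?_)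
    · refine mul_le_mul' le_rfl (measure_mono ?_)
      intro v hv j hj
      have h := hsel.2 (fun j => G j + η * v j) j
      change leader sel η G v = i at hv
      rw [leader] at hv
      rw [hv] at h
      rw [← le_sub_iff_add_le, div_le_iff₀ hη]
      linarith
    · intro v hv
      by_contra hne
      have h := hsel.2 (fun j => (G + Pi.single i a : Fin N → ℝ) j + η * v j) i
      change ¬ leader sel η (G + Pi.single i a) v = i at hne
      change _ ≤ (G + Pi.single i a : Fin N → ℝ) (leader sel η (G + Pi.single i a) v) +
        η * v (leader sel η (G + Pi.single i a) v) at h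
      have h2 := hv _ hne
      simp only [Pi.add_apply, Pi.single_eq_same, Pi.single_eq_of_ne hne] at h
      have h3 : (G (leader sel η (G + Pi.single i a) v) - G i) / η + -a / η <
          v i - v (leader sel η (G + Pi.single i a) v) := by linarith
      rw [← add_div, div_lt_iff₀ hη] at h3
      linarith
  have e : 1 + H * (a / η) = 1 - H * (-a / η) := by ring
  rw [e]
  have h := ENNReal.toReal_mono (measure_ne_top _ _) key2
  rw [ENNReal.toReal_mul, ENNReal.toReal_ofReal'] at h
  refine le_trans ?_ h
  exact mul_le_mul_of_nonneg_right (le_max_left _ _) measureReal_nonneg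

theorem integrable_pi_eval {D : Measure ℝ} [IsProbabilityMeasure D] {f : ℝ → ℝ}
    (hf : Integrable f D) (j : Fin N) :
    Integrable (fun v : Fin N → ℝ => f (v j)) (Measure.pi fun _ : Fin N => D) :=
  (measurePreserving_eval (fun _ : Fin N => D) j).integrable_comp_of_integrable hf

theorem integral_pi_eval {D : Measure ℝ} [IsProbabilityMeasure D] {f : ℝ → ℝ}
    (hf : Integrable f D) (j : Fin N) :
    ∫ v : Fin N → ℝ, f (v j) ∂(Measure.pi fun _ : Fin N => D) = ∫ x, f x ∂D := by
  have h := (measurePreserving_eval (fun _ : Fin N => D) j)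
  conv_rhs => rw [← h.map_eq]
  rw [integral_map h.measurable.aemeasurable (by rw [h.map_eq]; exact hf.aestronglyMeasurable)]

theorem measurable_iSup_add (η : ℝ) (G : Fin N → ℝ) :
    Measurable fun v : Fin N → ℝ => ⨆ j, (G j + η * v j) :=
  Measurable.iSup fun j => by fun_prop

theorem integrable_iSup_add {D : Measure ℝ} [IsProbabilityMeasure D] [Nonempty (Fin N)]
    (hD : Integrable (fun x => x) D) (η : ℝ) (G : Fin N → ℝ) :
    Integrable (fun v : Fin N → ℝ => ⨆ j, (G j + η * v j)) (Measure.pi fun _ : Fin N => D) := by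
  have hi : Integrable (fun v : Fin N → ℝ => ∑ j, |G j + η * v j|)
      (Measure.pi fun _ : Fin N => D) :=
    integrable_finsetSum _ fun j _ =>
      ((integrable_const (G j)).add ((integrable_pi_eval hD j).const_mul η)).abs
  refine hi.mono' (measurable_iSup_add η G).aestronglyMeasurable (ae_of_all _ fun v => ?_)
  obtain ⟨k, hk⟩ := exists_eq_ciSup_of_finite (f := fun j => G j + η * v j)
  rw [← hk]
  exact Finset.single_le_sum (f := fun j => |G j + η * v j|) (fun j _ => abs_nonneg _)
    (Finset.mem_univ k)

theorem potential_add_single_le {sel : (Fin N → ℝ) → Fin N} (hsel : IsLeaderRule sel) (η : ℝ)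
    {D : Measure ℝ} [IsProbabilityMeasure D] (hD : Integrable (fun x => x) D)
    (G : Fin N → ℝ) (i : Fin N) (a : ℝ) :
    potential η D (G + Pi.single i a) ≤
      potential η D G + a * playProb sel η D (G + Pi.single i a) i := by
  have : Nonempty (Fin N) := ⟨i⟩
  have hm := measurableSet_leader_eq hsel η (G + Pi.single i a) i
  have hind : Integrable ({v | leader sel η (G + Pi.single i a) v = i}.indicator fun _ => a)
      (Measure.pi fun _ : Fin N => D) := (integrable_const a).indicator hm
  have e : a * playProb sel η D (G + Pi.single i a) i =
      ∫ v, {v | leader sel η (G + Pi.single i a) v = i}.indicator (fun _ => a) v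
        ∂(Measure.pi fun _ : Fin N => D) := by
    rw [integral_indicator_const _ hm, smul_eq_mul, mul_comm]; rfl
  rw [e, potential, potential, ← integral_add (integrable_iSup_add hD η G) hind]
  refine integral_mono (integrable_iSup_add hD η _)
    ((integrable_iSup_add hD η G).add hind) fun v => ?_
  refine le_trans (ciSup_le fun j => hsel.2 (fun j => (G + Pi.single i a : Fin N → ℝ) j + η * v j) j) ?_
  change (G + Pi.single i a : Fin N → ℝ) (leader sel η (G + Pi.single i a) v) +
    η * v (leader sel η (G + Pi.single i a) v) ≤ _
  have hle := le_ciSup (Finite.bddAbove_range fun j => G j + η * v j)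
    (leader sel η (G + Pi.single i a) v)
  by_cases h : leader sel η (G + Pi.single i a) v = i
  · simp only [Pi.add_apply, indicator, mem_ofPred_eq, h, if_true, Pi.single_eq_same] at hle ⊢
    linarith
  · simp only [Pi.add_apply, indicator, mem_ofPred_eq, h, if_false, ne_eq, not_false_eq_true,
      Pi.single_eq_of_ne] at hle ⊢
    linarith

theorem add_le_potential {D : Measure ℝ} [IsProbabilityMeasure D]
    (hD : Integrable (fun x => x) D) (η : ℝ) (G : Fin N → ℝ) (i : Fin N) :
    G i + η * ∫ x, x ∂D ≤ potential η D G := by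
  have : Nonempty (Fin N) := ⟨i⟩
  have e : G i + η * ∫ x, x ∂D = ∫ v : Fin N → ℝ, (G i + η * v i)
      ∂(Measure.pi fun _ : Fin N => D) := by
    rw [integral_add (integrable_const _) ((integrable_pi_eval hD i).const_mul η),
      integral_const_mul, integral_pi_eval hD]
    simp
  rw [e, potential]
  exact integral_mono ((integrable_const (G i)).add ((integrable_pi_eval hD i).const_mul η))
    (integrable_iSup_add hD η G) fun v =>
      le_ciSup (Finite.bddAbove_range fun j => G j + η * v j) i

theorem potential_zero {η : ℝ} (hη : 0 ≤ η) (D : Measure ℝ) :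
    potential η D (0 : Fin N → ℝ) =
      η * ∫ v, (⨆ j, v j) ∂Measure.pi fun _ : Fin N => D := by
  simp only [potential, Pi.zero_apply, zero_add, ← Real.mul_iSup_of_nonneg hη,
    integral_const_mul]

/-- The estimate of the gain of a single action, along every realization. -/
theorem cumEstimate_apply_le {sel : (Fin N → ℝ) → Fin N} (hsel : IsLeaderRule sel) {η H : ℝ}
    (hη : 0 < η) (hH : 0 ≤ H) {D : Measure ℝ} [IsProbabilityMeasure D] (hD : HazardRateLE D H)
    (hDi : Integrable (fun x => x) D) (M : ℕ) {g : ℕ → Fin N → ℝ}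
    (hg : ∀ t i, g t i ∈ Icc (-1 : ℝ) 0) (z : ℕ → ℕ → Fin N → ℝ) (T : ℕ) (i : Fin N) :
    cumEstimate sel η M g z T i ≤
      η * (∫ v, (⨆ j, v j) ∂(Measure.pi fun _ : Fin N => D) - ∫ x, x ∂D) +
      ∑ t ∈ Finset.range T,
        (fun (p K x : ℝ) => p * (x * K) + H / η * (p * K ^ 2))
          (playProb sel η D (cumEstimate sel η M g z t) (action sel η M g z t))
          (resampleCount sel η M (cumEstimate sel η M g z t) (action sel η M g z t) (z t))
          (g t (action sel η M g z t)) := by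
  have step : ∀ T, potential η D (cumEstimate sel η M g z T) ≤ potential η D (0 : Fin N → ℝ) +
      ∑ t ∈ Finset.range T,
        (fun (p K x : ℝ) => p * (x * K) + H / η * (p * K ^ 2))
          (playProb sel η D (cumEstimate sel η M g z t) (action sel η M g z t))
          (resampleCount sel η M (cumEstimate sel η M g z t) (action sel η M g z t) (z t))
          (g t (action sel η M g z t)) := by
    intro T
    induction T with
    | zero => simp [cumEstimate]
    | succ t ih =>
      rw [Finset.sum_range_succ, ← add_assoc]
      set G := cumEstimate sel η M g z t
      set i := action sel η M g z t with hi
      have e : cumEstimate sel η M g z (t + 1) =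
        G + Pi.single i (g t i * (resampleCount sel η M G i (z t) : ℝ)) := rfl
      rw [e]
      set K : ℝ := (resampleCount sel η M G i (z t) : ℝ)
      have hK : 0 ≤ K := Nat.cast_nonneg _
      obtain ⟨h1, h2⟩ := hg t i
      have ha : g t i * K ≤ 0 := mul_nonpos_of_nonpos_of_nonneg h2 hK
      refine (potential_add_single_le hsel η hDi G i _).trans (add_le_add ih ?_)
      have hp := mul_le_mul_of_nonpos_left (le_playProb_add_single hsel hη hH hD G i ha) ha
      refine hp.trans ?_
      have hp0 := playProb_nonneg sel η D G i
      set p := playProb sel η D G i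
      have hsq : g t i ^ 2 ≤ 1 := by nlinarith
      have : H / η * (p * K ^ 2) * g t i ^ 2 ≤ H / η * (p * K ^ 2) * 1 := by gcongr
      calc g t i * K * ((1 + H * (g t i * K / η)) * p)
          = p * (g t i * K) + H / η * (p * K ^ 2) * g t i ^ 2 := by ring
        _ ≤ _ := by simpa using this
  have h1 := add_le_potential hDi η (cumEstimate sel η M g z T) i
  have h2 := step T
  rw [potential_zero hη.le] at h2
  linarith

theorem resampleCount_le (sel : (Fin N → ℝ) → Fin N) (η : ℝ) (M : ℕ) (G : Fin N → ℝ)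
    (i : Fin N) (w : ℕ → Fin N → ℝ) : resampleCount sel η M G i w ≤ M :=
  Nat.sInf_le (Or.inr rfl)

theorem lt_resampleCount_iff (sel : (Fin N → ℝ) → Fin N) (η : ℝ) {M : ℕ} (G : Fin N → ℝ)
    (i : Fin N) (w : ℕ → Fin N → ℝ) {k : ℕ} (hk : k < M) :
    k < resampleCount sel η M G i w ↔ ∀ j ∈ Finset.Icc 1 k, leader sel η G (w j) ≠ i := by
  constructor
  · intro h j hj hji
    rw [Finset.mem_Icc] at hj
    exact Nat.notMem_of_lt_sInf (hj.2.trans_lt h) (Or.inl ⟨hj.1, hji⟩)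
  · intro h
    by_contra! hle
    have hmem : resampleCount sel η M G i w ∈ {k | 1 ≤ k ∧ leader sel η G (w k) = i} ∪ {M} :=
      Nat.sInf_mem ⟨M, Or.inr rfl⟩
    rcases hmem with ⟨h1, h2⟩ | h3
    · exact h _ (Finset.mem_Icc.2 ⟨h1, hle⟩) h2
    · rw [mem_singleton_iff] at h3
      omega

/-- The event that the first `k` resampled leaders differ from `i`. -/
def missSet (sel : (Fin N → ℝ) → Fin N) (η : ℝ) (G : Fin N → ℝ) (i : Fin N) (k : ℕ) :
    Set (ℕ → Fin N → ℝ) :=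
  {w | ∀ j ∈ Finset.Icc 1 k, leader sel η G (w j) ≠ i}

theorem sum_range_resampleCount {R : Type*} [AddCommMonoid R] (sel : (Fin N → ℝ) → Fin N) (η : ℝ)
    (M : ℕ) (G : Fin N → ℝ) (i : Fin N) (w : ℕ → Fin N → ℝ) (h : ℕ → R) :
    ∑ k ∈ Finset.range (resampleCount sel η M G i w), h k =
      ∑ k ∈ Finset.range M, (missSet sel η G i k).indicator (fun _ => h k) w := by
  rw [← Finset.sum_subset (Finset.range_mono (resampleCount_le sel η M G i w))]
  · refine Finset.sum_congr rfl fun k hk => ?_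
    rw [Finset.mem_range] at hk
    rw [indicator_of_mem]
    exact (lt_resampleCount_iff sel η G i w (hk.trans_le (resampleCount_le sel η M G i w))).1 hk
  · intro k hk hk2
    rw [Finset.mem_range] at hk hk2
    rw [indicator_of_notMem]
    exact fun hm => hk2 ((lt_resampleCount_iff sel η G i w hk).2 hm)

theorem measurable_resampleCount {sel : (Fin N → ℝ) → Fin N} (hsel : IsLeaderRule sel) (η : ℝ)
    (M : ℕ) (i : Fin N) :
    Measurable fun q : (Fin N → ℝ) × (ℕ → Fin N → ℝ) => resampleCount sel η M q.1 i q.2 := by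
  have e : (fun q : (Fin N → ℝ) × (ℕ → Fin N → ℝ) => resampleCount sel η M q.1 i q.2) =
      fun q => ∑ k ∈ Finset.range M,
        {q : (Fin N → ℝ) × (ℕ → Fin N → ℝ) | q.2 ∈ missSet sel η q.1 i k}.indicator
          (fun _ => 1) q := by
    ext q
    have := sum_range_resampleCount sel η M q.1 i q.2 (fun _ => 1)
    rw [Finset.sum_const, Finset.card_range, smul_eq_mul, mul_one] at this
    exact this
  rw [e]
  refine Finset.measurable_sum _ fun k _ => measurable_const.indicator ?_
  have e' : {q : (Fin N → ℝ) × (ℕ → Fin N → ℝ) | q.2 ∈ missSet sel η q.1 i k} =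
      ⋂ j, ⋂ _ : j ∈ Finset.Icc 1 k, {q | leader sel η q.1 (q.2 j) ≠ i} := by
    ext q
    simp [missSet]
  rw [e']
  refine MeasurableSet.iInter fun j => MeasurableSet.iInter fun _ => ?_
  have hm : Measurable fun q : (Fin N → ℝ) × (ℕ → Fin N → ℝ) => leader sel η q.1 (q.2 j) :=
    (measurable_leader hsel η).comp (by fun_prop :
      Measurable fun q : (Fin N → ℝ) × (ℕ → Fin N → ℝ) => (q.1, q.2 j))
  exact hm (measurableSet_singleton i).compl

/-- The cumulative estimate, the action and the resampling count of a round. -/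
theorem measurable_round {sel : (Fin N → ℝ) → Fin N} (hsel : IsLeaderRule sel) (η : ℝ)
    (M : ℕ) : Measurable fun q : (Fin N → ℝ) × (ℕ → Fin N → ℝ) =>
      (q.1, leader sel η q.1 (q.2 0),
        resampleCount sel η M q.1 (leader sel η q.1 (q.2 0)) q.2) := by
  have h1 : Measurable fun q : (Fin N → ℝ) × (ℕ → Fin N → ℝ) => leader sel η q.1 (q.2 0) :=
    (measurable_leader hsel η).comp (by fun_prop :
      Measurable fun q : (Fin N → ℝ) × (ℕ → Fin N → ℝ) => (q.1, q.2 0))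
  have h2 : Measurable fun q : ((Fin N → ℝ) × (ℕ → Fin N → ℝ)) × Fin N =>
      resampleCount sel η M q.1.1 q.2 q.1.2 :=
    measurable_from_prod_countable_left fun i => measurable_resampleCount hsel η M i
  exact measurable_fst.prodMk (h1.prodMk (h2.comp (measurable_id.prodMk h1)))

/-- A function of the cumulative estimate, the action and the resampling count of a round. -/
theorem measurable_of_round {sel : (Fin N → ℝ) → Fin N} (hsel : IsLeaderRule sel) (η : ℝ)
    (M : ℕ) {β : Type*} [MeasurableSpace β] {f : (Fin N → ℝ) → Fin N → ℕ → β}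
    (hf : ∀ i k, Measurable fun G => f G i k) :
    Measurable fun q : (Fin N → ℝ) × (ℕ → Fin N → ℝ) =>
      f q.1 (leader sel η q.1 (q.2 0))
        (resampleCount sel η M q.1 (leader sel η q.1 (q.2 0)) q.2) := by
  have h : Measurable fun r : (Fin N → ℝ) × (Fin N × ℕ) => f r.1 r.2.1 r.2.2 :=
    measurable_from_prod_countable_left fun r => hf r.1 r.2
  exact h.comp (measurable_round hsel η M)

theorem measurable_playProb {sel : (Fin N → ℝ) → Fin N} (hsel : IsLeaderRule sel) (η : ℝ)
    (D : Measure ℝ) [IsProbabilityMeasure D] (i : Fin N) :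
    Measurable fun G => playProb sel η D G i :=
  (measurable_measure_prodMk_left
    (measurable_leader hsel η (measurableSet_singleton i))).ennreal_toReal

theorem measurable_round_apply {Ω : Type*} [MeasurableSpace Ω] (Z : Ω → ℕ → ℕ → Fin N → ℝ)
    (t : ℕ) (hZ : ∀ k j, Measurable fun ω => Z ω t k j) : Measurable fun ω => Z ω t :=
  measurable_pi_lambda _ fun k => measurable_pi_lambda _ fun j => hZ k j

theorem measurable_cumEstimate {sel : (Fin N → ℝ) → Fin N} (hsel : IsLeaderRule sel) (η : ℝ)
    (M : ℕ) (g : ℕ → Fin N → ℝ) {Ω : Type*} [MeasurableSpace Ω]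
    (Z : Ω → ℕ → ℕ → Fin N → ℝ) (t : ℕ)
    (hZ : ∀ s < t, ∀ k j, Measurable fun ω => Z ω s k j) :
    Measurable fun ω => cumEstimate sel η M g (Z ω) t := by
  induction t with
  | zero => exact measurable_const
  | succ t ih =>
    have h1 := ih fun s hs => hZ s (by omega)
    have h2 := measurable_round_apply Z t (hZ t (by omega))
    have h3 := measurable_of_round hsel η M
      (f := fun G i k => G + Pi.single i (g t i * (k : ℝ))) fun i k => by fun_prop
    exact h3.comp (h1.prodMk h2)

/-- The law of the perturbations of one round. -/
noncomputable def roundLaw (N : ℕ) (D : Measure ℝ) : Measure (ℕ → Fin N → ℝ) :=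
  Measure.infinitePi fun _ : ℕ => Measure.pi fun _ : Fin N => D

instance (D : Measure ℝ) [IsProbabilityMeasure D] : IsProbabilityMeasure (roundLaw N D) := by
  unfold roundLaw; infer_instance

theorem measurableSet_missSet {sel : (Fin N → ℝ) → Fin N} (hsel : IsLeaderRule sel) (η : ℝ)
    (G : Fin N → ℝ) (i : Fin N) (k : ℕ) : MeasurableSet (missSet sel η G i k) := by
  simp only [missSet, ofPred_forall]
  refine MeasurableSet.iInter fun j => MeasurableSet.iInter fun _ => ?_
  exact ((measurable_leader_right hsel η G).comp (measurable_pi_apply j))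
    (measurableSet_singleton i).compl

theorem roundLaw_real_inter {sel : (Fin N → ℝ) → Fin N} (hsel : IsLeaderRule sel) (η : ℝ)
    (D : Measure ℝ) [IsProbabilityMeasure D] (G : Fin N → ℝ) (i : Fin N) (k : ℕ) :
    (roundLaw N D).real ({w | leader sel η G (w 0) = i} ∩ missSet sel η G i k) =
      playProb sel η D G i * (1 - playProb sel η D G i) ^ k := by
  have hm := measurableSet_leader_eq hsel η G i
  have e : {w | leader sel η G (w 0) = i} ∩ missSet sel η G i k =
      Set.pi (Finset.range (k + 1)) fun j => if j = 0 then {v | leader sel η G v = i} else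
        {v | leader sel η G v = i}ᶜ := by
    ext w
    simp only [missSet, mem_inter_iff, mem_ofPred_eq, Set.mem_pi, Finset.mem_coe, Finset.mem_range,
      Finset.mem_Icc]
    constructor
    · rintro ⟨h0, h⟩ j hj
      by_cases hj0 : j = 0
      · simp [hj0, h0]
      · simp only [hj0, if_false, mem_compl_iff, mem_ofPred_eq]
        exact h j ⟨by omega, by omega⟩
    · intro h
      refine ⟨by simpa using h 0 (by omega), fun j hj => ?_⟩
      have := h j (by omega)
      simpa [show j ≠ 0 by omega] using this
  rw [e, measureReal_def, roundLaw, Measure.infinitePi_pi, Finset.prod_range_succ']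
  · simp only [Nat.add_eq_zero_iff, one_ne_zero, and_false, if_false, if_true,
      Finset.prod_const, Finset.card_range, ENNReal.toReal_mul, ENNReal.toReal_pow]
    rw [mul_comm]
    congr 2
    exact probReal_compl_eq_one_sub hm
  · intro j _
    split_ifs
    exacts [hm, hm.compl]

theorem integral_round {sel : (Fin N → ℝ) → Fin N} (hsel : IsLeaderRule sel) (η : ℝ)
    (D : Measure ℝ) [IsProbabilityMeasure D] (M : ℕ) (G c : Fin N → ℝ) (h : Fin N → ℕ → ℝ) :
    ∫ w, (c (leader sel η G (w 0)) + ∑ k ∈ Finset.range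
        (resampleCount sel η M G (leader sel η G (w 0)) w), h (leader sel η G (w 0)) k)
        ∂(roundLaw N D) =
      ∑ i, playProb sel η D G i *
        (c i + ∑ k ∈ Finset.range M, h i k * (1 - playProb sel η D G i) ^ k) := by
  have hm : ∀ i k, MeasurableSet ({w | leader sel η G (w 0) = i} ∩ missSet sel η G i k) :=
    fun i k => (((measurable_leader_right hsel η G).comp (measurable_pi_apply 0))
      (measurableSet_singleton i)).inter (measurableSet_missSet hsel η G i k)
  have e : ∀ w, (c (leader sel η G (w 0)) + ∑ k ∈ Finset.range
        (resampleCount sel η M G (leader sel η G (w 0)) w), h (leader sel η G (w 0)) k) =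
      ∑ i, (({w | leader sel η G (w 0) = i} ∩ missSet sel η G i 0).indicator (fun _ => c i) w +
        ∑ k ∈ Finset.range M,
          ({w | leader sel η G (w 0) = i} ∩ missSet sel η G i k).indicator
            (fun _ => h i k) w) := by
    intro w
    rw [Finset.sum_eq_single (leader sel η G (w 0))]
    · rw [sum_range_resampleCount]
      congr 1
      · rw [indicator_of_mem]
        simp [missSet]
      · refine Finset.sum_congr rfl fun k _ => ?_
        by_cases hw : w ∈ missSet sel η G (leader sel η G (w 0)) k
        · rw [indicator_of_mem hw, indicator_of_mem
            (show w ∈ {w' | leader sel η G (w' 0) = leader sel η G (w 0)} ∩ missSet sel η G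
              (leader sel η G (w 0)) k from ⟨rfl, hw⟩)]
        · rw [indicator_of_notMem hw, indicator_of_notMem fun h => hw h.2]
    · intro i _ hi
      simp [indicator, hi.symm]
    · simp
  simp_rw [e]
  have hi : ∀ i k (a : ℝ), Integrable
      (({w | leader sel η G (w 0) = i} ∩ missSet sel η G i k).indicator (fun _ => a))
      (roundLaw N D) := fun i k a => (integrable_const a).indicator (hm i k)
  rw [integral_finsetSum]
  · refine Finset.sum_congr rfl fun i _ => ?_
    rw [integral_add (hi i 0 _) (integrable_finsetSum _ fun k _ => hi i k _),
      integral_finsetSum _ fun k _ => hi i k _, mul_add, Finset.mul_sum]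
    simp only [integral_indicator_const _ (hm _ _), smul_eq_mul,
      roundLaw_real_inter hsel η D G]
    congr 1
    · simp
    · exact Finset.sum_congr rfl fun k _ => by ring
  · exact fun i _ => (hi i 0 _).add (integrable_finsetSum _ fun k _ => hi i k _)

theorem mul_geom_sum_one_sub (p : ℝ) (M : ℕ) :
    p * ∑ k ∈ Finset.range M, (1 - p) ^ k = 1 - (1 - p) ^ M := by
  have := mul_neg_geom_sum (1 - p) M
  simpa using this

theorem mul_one_sub_pow_le {p : ℝ} (h0 : 0 ≤ p) (h1 : p ≤ 1) {M : ℕ} (hM : 1 ≤ M) :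
    p * (1 - p) ^ M ≤ 1 / M := by
  have hM' : (0 : ℝ) < M := by exact_mod_cast hM
  have hq : 0 ≤ 1 - p := by linarith
  rw [le_div_iff₀ hM']
  calc p * (1 - p) ^ M * M = p * ∑ k ∈ Finset.range M, (1 - p) ^ M := by
        rw [Finset.sum_const, Finset.card_range, nsmul_eq_mul]; ring
    _ ≤ p * ∑ k ∈ Finset.range M, (1 - p) ^ k := by
        refine mul_le_mul_of_nonneg_left (Finset.sum_le_sum fun k hk => ?_) h0
        exact pow_le_pow_of_le_one hq (by linarith) (Finset.mem_range.1 hk).le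
    _ = 1 - (1 - p) ^ M := mul_geom_sum_one_sub p M
    _ ≤ 1 := by have := pow_nonneg hq M; linarith

theorem sq_mul_sum_le_two {p : ℝ} (h0 : 0 ≤ p) (h1 : p ≤ 1) (M : ℕ) :
    p ^ 2 * ∑ k ∈ Finset.range M, (2 * k + 1) * (1 - p) ^ k ≤ 2 := by
  have hq : 0 ≤ 1 - p := by linarith
  have key : p ^ 2 * ∑ k ∈ Finset.range M, (k + 1) * (1 - p) ^ k =
      1 - (1 - p) ^ M * (1 + M * p) := by
    induction M with
    | zero => simp
    | succ n ih =>
      rw [Finset.sum_range_succ, mul_add, ih]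
      push_cast
      ring
  calc p ^ 2 * ∑ k ∈ Finset.range M, (2 * k + 1) * (1 - p) ^ k
      ≤ p ^ 2 * ∑ k ∈ Finset.range M, 2 * ((k + 1) * (1 - p) ^ k) := by
        refine mul_le_mul_of_nonneg_left (Finset.sum_le_sum fun k _ => ?_) (sq_nonneg p)
        have := pow_nonneg hq k
        nlinarith
    _ = 2 * (1 - (1 - p) ^ M * (1 + M * p)) := by rw [← Finset.mul_sum, ← key]; ring
    _ ≤ 2 := by
        have : 0 ≤ (1 - p) ^ M * (1 + M * p) := by positivity
        linarith

/-- The expected contribution of one round. -/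
theorem integral_round_le {sel : (Fin N → ℝ) → Fin N} (hsel : IsLeaderRule sel) (η : ℝ)
    (D : Measure ℝ) [IsProbabilityMeasure D] {M : ℕ} (hM : 1 ≤ M) (G : Fin N → ℝ)
    {x : Fin N → ℝ} (hx : ∀ i, x i ∈ Icc (-1 : ℝ) 0) {a : ℝ} (ha : 0 ≤ a) (i₀ : Fin N) :
    ∫ w, ((fun i => x i₀ - x i) (leader sel η G (w 0)) + ∑ k ∈ Finset.range
        (resampleCount sel η M G (leader sel η G (w 0)) w),
        (fun i (k : ℕ) => playProb sel η D G i * x i + a * (playProb sel η D G i * (2 * k + 1)) -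
          (if i = i₀ then x i else 0)) (leader sel η G (w 0)) k) ∂(roundLaw N D) ≤
      N / M + 2 * N * a := by
  refine (integral_round hsel η D M G (fun i => x i₀ - x i) (fun i (k : ℕ) =>
    playProb sel η D G i * x i + a * (playProb sel η D G i * (2 * k + 1)) -
      (if i = i₀ then x i else 0))).trans_le ?_
  have hp0 := playProb_nonneg sel η D G
  have hp1 := playProb_le_one sel η D G
  have hsum : ∑ i, playProb sel η D G i = 1 := by
    have h := sum_measureReal_preimage_singleton (μ := Measure.pi fun _ : Fin N => D)
      (f := leader sel η G) Finset.univ fun i _ => measurableSet_leader_eq hsel η G i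
    exact h.trans (by simp)
  set p := playProb sel η D G
  have e : ∀ i, p i * (x i₀ - x i + ∑ k ∈ Finset.range M,
        (p i * x i + a * (p i * (2 * k + 1)) - (if i = i₀ then x i else 0)) * (1 - p i) ^ k) =
      p i * x i₀ + (- x i) * (p i * (1 - p i) ^ M) +
      a * (p i ^ 2 * ∑ k ∈ Finset.range M, (2 * k + 1) * (1 - p i) ^ k) +
      (if i = i₀ then - x i * (1 - (1 - p i) ^ M) else 0) := by
    intro i
    have h1 := mul_geom_sum_one_sub (p i) M
    have h2 : ∑ k ∈ Finset.range M,
        (p i * x i + a * (p i * (2 * k + 1)) - (if i = i₀ then x i else 0)) * (1 - p i) ^ k =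
        (p i * x i - (if i = i₀ then x i else 0)) * ∑ k ∈ Finset.range M, (1 - p i) ^ k +
        a * p i * ∑ k ∈ Finset.range M, (2 * k + 1) * (1 - p i) ^ k := by
      rw [Finset.mul_sum, Finset.mul_sum, ← Finset.sum_add_distrib]
      exact Finset.sum_congr rfl fun k _ => by ring
    rw [h2]
    split_ifs
    · linear_combination (p i * x i - x i) * h1
    · linear_combination (p i * x i) * h1
  rw [Finset.sum_congr rfl fun i _ => e i]
  simp only [Finset.sum_add_distrib, ← Finset.sum_mul, hsum, Finset.sum_ite_eq',
    Finset.mem_univ, if_true]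
  have b1 : ∑ i, (- x i) * (p i * (1 - p i) ^ M) ≤ N / M := by
    calc ∑ i, (- x i) * (p i * (1 - p i) ^ M) ≤ ∑ _i : Fin N, (1 : ℝ) / M := by
          refine Finset.sum_le_sum fun i _ => ?_
          have h := mul_one_sub_pow_le (hp0 i) (hp1 i) hM
          have h0 : 0 ≤ p i * (1 - p i) ^ M :=
            mul_nonneg (hp0 i) (pow_nonneg (by linarith [hp1 i]) _)
          obtain ⟨h2, h3⟩ := hx i
          nlinarith
      _ = N / M := by simp [div_eq_mul_inv]
  have b2 : ∑ i, a * (p i ^ 2 * ∑ k ∈ Finset.range M, (2 * k + 1) * (1 - p i) ^ k) ≤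
      2 * N * a := by
    calc _ ≤ ∑ _i : Fin N, a * 2 :=
          Finset.sum_le_sum fun i _ =>
            mul_le_mul_of_nonneg_left (sq_mul_sum_le_two (hp0 i) (hp1 i) M) ha
      _ = 2 * N * a := by simp; ring
  have b3 : 0 ≤ (- x i₀) * (1 - p i₀) ^ M :=
    mul_nonneg (by linarith [(hx i₀).2]) (pow_nonneg (by linarith [hp1 i₀]) _)
  linarith

theorem IsIID.map_round {Ω : Type*} [MeasurableSpace Ω] {P : Measure Ω} [IsProbabilityMeasure P]
    {D : Measure ℝ} [IsProbabilityMeasure D] {Z : Ω → ℕ → ℕ → Fin N → ℝ} (hZ : IsIID P D Z)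
    (t : ℕ) : P.map (fun ω => Z ω t) = roundLaw N D := by
  obtain ⟨hm, hl, hi⟩ := hZ
  have hinj : Function.Injective fun s : (_ : ℕ) × Fin N => (t, s.1, s.2) := by
    rintro ⟨k, j⟩ ⟨k', j'⟩ h
    simp only [Prod.mk.injEq, true_and] at h
    obtain ⟨rfl, rfl⟩ := h
    rfl
  have h1 := hi.precomp hinj
  rw [iIndepFun_iff_map_fun_eq_infinitePi_map (fun s => hm _ _ _)] at h1
  simp only [hl] at h1
  have h2 := Measure.infinitePi_map_piCurry (X := fun (_ : ℕ) (_ : Fin N) => ℝ)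
    (fun (_ : ℕ) (_ : Fin N) => D)
  rw [← h1, Measure.map_map (by fun_prop)
    (measurable_pi_lambda _ fun s => hm _ _ _)] at h2
  simp only [Measure.infinitePi_eq_pi] at h2
  exact h2

theorem IsIID.indepFun_cumEstimate {Ω : Type*} [MeasurableSpace Ω] {P : Measure Ω}
    {D : Measure ℝ} {Z : Ω → ℕ → ℕ → Fin N → ℝ} (hZ : IsIID P D Z)
    {sel : (Fin N → ℝ) → Fin N} (hsel : IsLeaderRule sel) (η : ℝ) (M : ℕ) (g : ℕ → Fin N → ℝ)
    (t : ℕ) : IndepFun (fun ω => cumEstimate sel η M g (Z ω) t) (fun ω => Z ω t) P := by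
  obtain ⟨hm, -, hi⟩ := hZ
  have hd : Disjoint {q : ℕ × ℕ × Fin N | q.1 < t} {q | q.1 = t} := by
    rw [Set.disjoint_left]
    exact fun q hq hq' => (ne_of_lt hq) hq'
  have h := indep_iSup_of_disjoint (fun q => (hm q.1 q.2.1 q.2.2).comap_le) hi.iIndep hd
  rw [IndepFun_iff_Indep]
  refine indep_of_indep_of_le_left (indep_of_indep_of_le_right h ?_) ?_
  · rw [← measurable_iff_comap_le]
    refine @measurable_round_apply N Ω (_) Z t fun k j => ?_
    rw [measurable_iff_comap_le]
    exact le_iSup₂_of_le (t, k, j) rfl le_rfl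
  · rw [← measurable_iff_comap_le]
    refine @measurable_cumEstimate N sel hsel η M g Ω (_) Z t fun s hs k j => ?_
    rw [measurable_iff_comap_le]
    exact le_iSup₂_of_le (s, k, j) hs le_rfl

theorem integral_le_of_indepFun {Ω α β : Type*} [MeasurableSpace Ω] [MeasurableSpace α]
    [MeasurableSpace β] {P : Measure Ω} [IsProbabilityMeasure P] {X : Ω → α} {Y : Ω → β}
    (hX : Measurable X) (hY : Measurable Y) (hXY : IndepFun X Y P) {F : α × β → ℝ}
    (hF : Measurable F) {C b : ℝ} (hC : ∀ q, |F q| ≤ C)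
    (hb : ∀ x, ∫ y, F (x, y) ∂(P.map Y) ≤ b) :
    Integrable (fun ω => F (X ω, Y ω)) P ∧ ∫ ω, F (X ω, Y ω) ∂P ≤ b := by
  have hXm : IsProbabilityMeasure (P.map X) := Measure.isProbabilityMeasure_map hX.aemeasurable
  have hYm : IsProbabilityMeasure (P.map Y) := Measure.isProbabilityMeasure_map hY.aemeasurable
  have hint : Integrable F ((P.map X).prod (P.map Y)) :=
    Integrable.of_bound hF.aestronglyMeasurable C (ae_of_all _ hC)
  refine ⟨Integrable.of_bound (hF.comp (hX.prodMk hY)).aestronglyMeasurable C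
    (ae_of_all _ fun ω => hC _), ?_⟩
  have e : ∫ ω, F (X ω, Y ω) ∂P = ∫ q, F q ∂(P.map fun ω => (X ω, Y ω)) :=
    (integral_map (hX.prodMk hY).aemeasurable hF.aestronglyMeasurable).symm
  rw [e, (indepFun_iff_map_prod_eq_prod_map_map hX.aemeasurable hY.aemeasurable).1 hXY,
    integral_prod _ hint]
  calc _ ≤ ∫ _, b ∂(P.map X) := integral_mono hint.integral_prod_left (integrable_const b) hb
    _ = b := by simp

theorem cumEstimate_apply (sel : (Fin N → ℝ) → Fin N) (η : ℝ) (M : ℕ) (g : ℕ → Fin N → ℝ)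
    (z : ℕ → ℕ → Fin N → ℝ) (T : ℕ) (i : Fin N) :
    cumEstimate sel η M g z T i = ∑ t ∈ Finset.range T,
      (if action sel η M g z t = i then g t (action sel η M g z t) *
        (resampleCount sel η M (cumEstimate sel η M g z t) (action sel η M g z t) (z t) : ℝ)
      else 0) := by
  induction T with
  | zero => simp [cumEstimate]
  | succ n ih =>
    rw [Finset.sum_range_succ, ← ih]
    change cumEstimate sel η M g z n i + (Pi.single (action sel η M g z n)
      (g n (action sel η M g z n) * (resampleCount sel η M (cumEstimate sel η M g z n)
        (action sel η M g z n) (z n) : ℝ)) : Fin N → ℝ) i = _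
    rw [Pi.single_apply]
    simp only [eq_comm]

/-- The regret bound for perturbations with bounded hazard rate. -/
theorem expectedRegretAtMost_of_hazardRateLE {D : Measure ℝ} [IsProbabilityMeasure D]
    {η H B : ℝ} (hη : 0 < η) (hH : 0 ≤ H) (hD : HazardRateLE D H)
    (hDi : Integrable (fun x => x) D) {M : ℕ} (hN : 1 ≤ N) (hM : 1 ≤ M) (T : ℕ)
    (hB : ∫ v, (⨆ j, v j) ∂(Measure.pi fun _ : Fin N => D) - ∫ x, x ∂D ≤ B) :
    ExpectedRegretAtMost D η N T M (η * B + T * (N / M + 2 * N * (H / η))) := by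
  intro Ω _ P _ Z hZ sel hsel g hg
  have : Nonempty (Fin N) := ⟨⟨0, hN⟩⟩
  have ha : 0 ≤ H / η := div_nonneg hH hη.le
  have hZt : ∀ t, Measurable fun ω => Z ω t := fun t => measurable_round_apply Z t (hZ.1 t)
  have hG : ∀ t, Measurable fun ω => cumEstimate sel η M g (Z ω) t := fun t =>
    measurable_cumEstimate hsel η M g Z t fun s _ => hZ.1 s
  obtain ⟨i₀, hi₀⟩ := Finite.exists_max fun i => ∑ t ∈ Finset.range T, g t i
  have hreg : ∀ z, regret sel η M g T z =
      ∑ t ∈ Finset.range T, (g t i₀ - g t (action sel η M g z t)) := by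
    intro z
    refine le_antisymm (ciSup_le fun i => ?_) (le_ciSup (f := fun i => ∑ t ∈ Finset.range T,
      (g t i - g t (action sel η M g z t))) (Finite.bddAbove_range _) i₀)
    simp only [Finset.sum_sub_distrib]
    linarith [hi₀ i]
  have hact : ∀ t, Measurable fun ω => action sel η M g (Z ω) t := fun t =>
    (measurable_leader hsel η).comp ((hG t).prodMk ((measurable_pi_apply 0).comp (hZt t)))
  have hrint : Integrable (fun ω => regret sel η M g T (Z ω)) P := by
    simp only [hreg]
    refine integrable_finsetSum _ fun t _ => Integrable.of_bound (C := 1) ?_ (ae_of_all _ ?_)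
    · exact (measurable_const.sub ((measurable_of_finite (g t)).comp
        (hact t))).aestronglyMeasurable
    · intro ω
      obtain ⟨h1, h2⟩ := hg t i₀
      obtain ⟨h3, h4⟩ := hg t (action sel η M g (Z ω) t)
      rw [Real.norm_eq_abs, abs_le]
      constructor <;> linarith
  refine ⟨hrint, ?_⟩
  let f : ℕ → (Fin N → ℝ) → Fin N → ℕ → ℝ := fun t G i K =>
    (g t i₀ - g t i) + ∑ k ∈ Finset.range K, (playProb sel η D G i * g t i +
      H / η * (playProb sel η D G i * (2 * k + 1)) - (if i = i₀ then g t i else 0))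
  let F : ℕ → (Fin N → ℝ) × (ℕ → Fin N → ℝ) → ℝ := fun t q =>
    f t q.1 (leader sel η q.1 (q.2 0))
      (resampleCount sel η M q.1 (leader sel η q.1 (q.2 0)) q.2)
  have hF : ∀ t, Measurable (F t) := fun t => measurable_of_round hsel η M fun i k => by
    have := measurable_playProb hsel η D i
    fun_prop
  have hFb : ∀ t q, |F t q| ≤ 1 + M * (2 + H / η * (2 * M + 1)) := by
    intro t q
    set i := leader sel η q.1 (q.2 0)
    set K := resampleCount sel η M q.1 i q.2 with hK
    have hKM : K ≤ M := resampleCount_le _ _ _ _ _ _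
    have hp0 := playProb_nonneg sel η D q.1 i
    have hp1 := playProb_le_one sel η D q.1 i
    obtain ⟨h1, h2⟩ := hg t i₀
    obtain ⟨h3, h4⟩ := hg t i
    change |(g t i₀ - g t i) + ∑ k ∈ Finset.range K, _| ≤ _
    refine (abs_add_le _ _).trans (add_le_add (abs_le.2 ⟨by linarith, by linarith⟩) ?_)
    refine (Finset.abs_sum_le_sum_abs _ _).trans ?_
    calc _ ≤ ∑ k ∈ Finset.range K, (2 + H / η * (2 * M + 1)) := by
          refine Finset.sum_le_sum fun k hk => ?_
          have hkM : (k : ℝ) ≤ M := by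
            exact_mod_cast (Finset.mem_range.1 hk).le.trans hKM
          have h5 : |playProb sel η D q.1 i * g t i| ≤ 1 := by
            rw [abs_le]; constructor <;> nlinarith
          have h6 : |H / η * (playProb sel η D q.1 i * (2 * k + 1))| ≤
              H / η * (2 * M + 1) := by
            rw [abs_of_nonneg (by positivity)]
            refine mul_le_mul_of_nonneg_left ?_ ha
            calc playProb sel η D q.1 i * (2 * k + 1) ≤ 1 * (2 * M + 1) := by gcongr
              _ = _ := one_mul _
          have h7 : |(if i = i₀ then g t i else 0)| ≤ 1 := by
            split_ifs
            · rw [abs_le]; constructor <;> linarith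
            · simp
          have h8 := abs_sub (playProb sel η D q.1 i * g t i +
            H / η * (playProb sel η D q.1 i * (2 * k + 1))) (if i = i₀ then g t i else 0)
          have h9 := abs_add_le (playProb sel η D q.1 i * g t i)
            (H / η * (playProb sel η D q.1 i * (2 * k + 1)))
          linarith
      _ = K * (2 + H / η * (2 * M + 1)) := by
          rw [Finset.sum_const, Finset.card_range, nsmul_eq_mul]
      _ ≤ _ := by gcongr
  have hround : ∀ t, Integrable (fun ω => F t (cumEstimate sel η M g (Z ω) t, Z ω t)) P ∧
      ∫ ω, F t (cumEstimate sel η M g (Z ω) t, Z ω t) ∂P ≤ N / M + 2 * N * (H / η) := by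
    intro t
    refine integral_le_of_indepFun (hG t) (hZt t) (hZ.indepFun_cumEstimate hsel η M g t) (hF t)
      (hFb t) fun G => ?_
    rw [hZ.map_round t]
    exact integral_round_le hsel η D hM G (hg t) ha i₀
  have hpath : ∀ ω, regret sel η M g T (Z ω) ≤ η * B +
      ∑ t ∈ Finset.range T, F t (cumEstimate sel η M g (Z ω) t, Z ω t) := by
    intro ω
    have h1 := cumEstimate_apply_le hsel hη hH hD hDi M hg (Z ω) T i₀
    rw [cumEstimate_apply] at h1
    have h2 : η * (∫ v, (⨆ j, v j) ∂(Measure.pi fun _ : Fin N => D) - ∫ x, x ∂D) ≤ η * B :=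
      mul_le_mul_of_nonneg_left hB hη.le
    have h3 : ∀ t, F t (cumEstimate sel η M g (Z ω) t, Z ω t) =
        (g t i₀ - g t (action sel η M g (Z ω) t)) +
        (fun (p K x : ℝ) => p * (x * K) + H / η * (p * K ^ 2))
          (playProb sel η D (cumEstimate sel η M g (Z ω) t) (action sel η M g (Z ω) t))
          (resampleCount sel η M (cumEstimate sel η M g (Z ω) t)
            (action sel η M g (Z ω) t) (Z ω t))
          (g t (action sel η M g (Z ω) t)) -
        (if action sel η M g (Z ω) t = i₀ then g t (action sel η M g (Z ω) t) *
          (resampleCount sel η M (cumEstimate sel η M g (Z ω) t) (action sel η M g (Z ω) t)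
            (Z ω t) : ℝ) else 0) := by
      intro t
      change f t _ (action sel η M g (Z ω) t) (resampleCount sel η M _
        (action sel η M g (Z ω) t) (Z ω t)) = _
      set i := action sel η M g (Z ω) t
      set G := cumEstimate sel η M g (Z ω) t
      set K := resampleCount sel η M G i (Z ω t)
      have hodd : ∑ k ∈ Finset.range K, (2 * (k : ℝ) + 1) = (K : ℝ) ^ 2 := by
        induction K with
        | zero => simp
        | succ n ih => rw [Finset.sum_range_succ, ih]; push_cast; ring
      simp only [f, Finset.sum_sub_distrib, Finset.sum_add_distrib, ← Finset.mul_sum,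
        Finset.sum_const, Finset.card_range, nsmul_eq_mul] at hodd ⊢
      split_ifs <;> linear_combination (H / η * playProb sel η D G i) * hodd
    simp only [h3, Finset.sum_sub_distrib, Finset.sum_add_distrib, hreg] at h1 ⊢
    linarith
  calc ∫ ω, regret sel η M g T (Z ω) ∂P
      ≤ ∫ ω, (η * B + ∑ t ∈ Finset.range T, F t (cumEstimate sel η M g (Z ω) t, Z ω t)) ∂P :=
        integral_mono hrint ((integrable_const _).add
          (integrable_finsetSum _ fun t _ => (hround t).1)) hpath
    _ = η * B + ∑ t ∈ Finset.range T,
          ∫ ω, F t (cumEstimate sel η M g (Z ω) t, Z ω t) ∂P := by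
        rw [integral_add (integrable_const _) (integrable_finsetSum _ fun t _ => (hround t).1),
          integral_finsetSum _ fun t _ => (hround t).1]
        simp
    _ ≤ η * B + ∑ t ∈ Finset.range T, (N / M + 2 * N * (H / η)) := by
        gcongr with t _
        exact (hround t).2
    _ = _ := by rw [Finset.sum_const, Finset.card_range, nsmul_eq_mul]

theorem hazardRateLE_withDensity {f : ℝ → ℝ≥0∞} [IsFiniteMeasure (volume.withDensity f)] {H : ℝ}
    (hH : 0 ≤ H) (hf : ∀ y, f y ≤ ENNReal.ofReal H * volume.withDensity f (Ioi y)) :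
    HazardRateLE (volume.withDensity f) H := by
  intro x δ hδ
  set D := volume.withDensity f with hD
  have h1 : D (Icc x (x + δ)) ≤ ENNReal.ofReal (H * δ) * D (Ici x) := by
    rw [hD, withDensity_apply _ measurableSet_Icc, ← hD]
    calc ∫⁻ y in Icc x (x + δ), f y ≤ ∫⁻ _ in Icc x (x + δ), ENNReal.ofReal H * D (Ici x) := by
          refine setLIntegral_mono measurable_const fun y hy => (hf y).trans ?_
          gcongr
          exact fun z hz => hy.1.trans (le_of_lt hz)
      _ = ENNReal.ofReal (H * δ) * D (Ici x) := by
          rw [setLIntegral_const, Real.volume_Icc, add_sub_cancel_left, ENNReal.ofReal_mul hH]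
          ring
  have h2 : D (Ici x) ≤ D (Ioi (x + δ)) + ENNReal.ofReal (H * δ) * D (Ici x) := by
    calc D (Ici x) ≤ D (Ioi (x + δ) ∪ Icc x (x + δ)) := by
          refine measure_mono fun y hy => ?_
          rcases lt_or_ge (x + δ) y with h | h
          exacts [Or.inl h, Or.inr ⟨hy, h⟩]
      _ ≤ D (Ioi (x + δ)) + D (Icc x (x + δ)) := measure_union_le _ _
      _ ≤ _ := by gcongr
  rw [ENNReal.ofReal_sub _ (mul_nonneg hH hδ), ENNReal.ofReal_one, ENNReal.sub_mul, one_mul]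
  · exact tsub_le_iff_right.2 h2
  · exact fun _ _ => measure_ne_top _ _

theorem lintegral_Ioi_eq_of_hasDerivAt_neg {f S : ℝ → ℝ} {y : ℝ}
    (hS : ∀ x ∈ Ici y, HasDerivAt S (-f x) x) (hf : ∀ x ∈ Ioi y, 0 ≤ f x)
    (ht : Tendsto S atTop (𝓝 0)) :
    ∫⁻ x in Ioi y, ENNReal.ofReal (f x) = ENNReal.ofReal (S y) := by
  have hd : ∀ x ∈ Ici y, HasDerivAt (fun x => - S x) (f x) x := fun x hx => by
    simpa using (hS x hx).fun_neg
  have hi := integrableOn_Ioi_deriv_of_nonneg' hd hf ht.neg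
  have he := integral_Ioi_of_hasDerivAt_of_nonneg' hd hf ht.neg
  rw [← ofReal_integral_eq_lintegral_ofReal hi
    ((ae_restrict_iff' measurableSet_Ioi).2 (ae_of_all _ hf)), he]
  simp

theorem integral_iSup_le {D : Measure ℝ} [IsProbabilityMeasure D] (hN : 1 ≤ N)
    (hD : Integrable (fun x => x) D) (L : ℝ) :
    ∫ v, (⨆ j, v j) ∂(Measure.pi fun _ : Fin N => D) ≤ L + N * ∫ x, max (x - L) 0 ∂D := by
  have : Nonempty (Fin N) := ⟨⟨0, hN⟩⟩
  have hm : Integrable (fun x => max (x - L) 0) D :=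
    (hD.sub (integrable_const L)).pos_part
  have hi : Integrable (fun v : Fin N → ℝ => ∑ j, max (v j - L) 0)
      (Measure.pi fun _ : Fin N => D) :=
    integrable_finsetSum _ fun j _ => integrable_pi_eval hm j
  have h1 := integrable_iSup_add (N := N) hD 1 0
  simp only [Pi.zero_apply, zero_add, one_mul] at h1
  calc _ ≤ ∫ v, (L + ∑ j, max (v j - L) 0) ∂(Measure.pi fun _ : Fin N => D) := by
        refine integral_mono h1 ((integrable_const L).add hi) fun v => ciSup_le fun j => ?_
        have h2 := Finset.single_le_sum (f := fun j => max (v j - L) 0)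
          (fun j _ => le_max_right _ _) (Finset.mem_univ j)
        have h3 := le_max_left (v j - L) 0
        simp only at h2 ⊢
        linarith
    _ = _ := by
        rw [integral_add (integrable_const L) hi,
          integral_finsetSum _ fun j _ => integrable_pi_eval hm j]
        simp only [integral_pi_eval hm]
        simp

theorem integrable_of_lintegral_ofReal_le {D : Measure ℝ} {f : ℝ → ℝ} (hf : Measurable f)
    (h0 : ∀ x, 0 ≤ f x) {A : ℝ} (hA : 0 ≤ A)
    (h : ∫⁻ x, ENNReal.ofReal (f x) ∂D ≤ ENNReal.ofReal A) :
    Integrable f D ∧ ∫ x, f x ∂D ≤ A := by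
  refine ⟨(lintegral_ofReal_ne_top_iff_integrable hf.aestronglyMeasurable (ae_of_all _ h0)).1
    (h.trans_lt ENNReal.ofReal_lt_top).ne, ?_⟩
  rw [integral_eq_lintegral_of_nonneg_ae (ae_of_all _ h0) hf.aestronglyMeasurable]
  exact ENNReal.toReal_le_of_le_ofReal hA h

/-- The expected maximum of perturbations with an exponential moment. -/
theorem integral_iSup_sub_le_of_exp_moment {D : Measure ℝ} [IsProbabilityMeasure D] {m s A : ℝ}
    (hs : 0 < s) (hA : 0 ≤ A)
    (h : ∫⁻ x, ENNReal.ofReal (Real.exp (s * |x - m|)) ∂D ≤ ENNReal.ofReal A) (hN : 1 ≤ N) :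
    Integrable (fun x => x) D ∧
      ∫ v, (⨆ j, v j) ∂(Measure.pi fun _ : Fin N => D) - ∫ x, x ∂D ≤
        (Real.log N + 2 * A) / s := by
  obtain ⟨hi, hle⟩ := integrable_of_lintegral_ofReal_le (by fun_prop)
    (fun x => (Real.exp_pos _).le) hA h
  have hN0 : (0 : ℝ) < N := by exact_mod_cast hN
  have hi' := hi.const_mul s⁻¹
  have habs : ∀ x, |x - m| ≤ s⁻¹ * Real.exp (s * |x - m|) := fun x => by
    rw [← div_eq_inv_mul, le_div_iff₀ hs]
    linarith [Real.add_one_le_exp (s * |x - m|)]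
  have hsub : Integrable (fun x => x - m) D :=
    hi'.mono' (by fun_prop) (ae_of_all _ habs)
  have hD : Integrable (fun x => x) D := by
    exact (hsub.add (integrable_const m)).congr (ae_of_all _ fun x => by simp)
  refine ⟨hD, ?_⟩
  set L := m + Real.log N / s with hL
  have h1 := integral_iSup_le hN hD L
  have h2 : ∫ x, max (x - L) 0 ∂D ≤ (N : ℝ)⁻¹ * (s⁻¹ * A) := by
    calc ∫ x, max (x - L) 0 ∂D
        ≤ ∫ x, (N : ℝ)⁻¹ * (s⁻¹ * Real.exp (s * |x - m|)) ∂D := by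
          refine integral_mono (hD.sub (integrable_const L)).pos_part (hi'.const_mul _)
            fun x => max_le ?_ (by positivity)
          have e1 : (N : ℝ)⁻¹ = Real.exp (- Real.log N) := by
            rw [Real.exp_neg, Real.exp_log hN0]
          rw [mul_left_comm, ← div_eq_inv_mul, le_div_iff₀ hs, e1, ← Real.exp_add]
          have h3 : s * (x - m) ≤ s * |x - m| := by gcongr; exact le_abs_self _
          have h4 : (x - L) * s = s * (x - m) - Real.log N := by
            rw [hL]; field_simp; ring
          have h5 := Real.add_one_le_exp (- Real.log N + s * |x - m|)
          linarith
      _ = (N : ℝ)⁻¹ * (s⁻¹ * ∫ x, Real.exp (s * |x - m|) ∂D) := by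
          rw [integral_const_mul, integral_const_mul]
      _ ≤ _ := by gcongr
  have h3 : m - ∫ x, x ∂D ≤ s⁻¹ * A := by
    calc m - ∫ x, x ∂D = ∫ x, (m - x) ∂D := by
          rw [integral_sub (integrable_const m) hD]; simp
      _ ≤ ∫ x, s⁻¹ * Real.exp (s * |x - m|) ∂D := by
          refine integral_mono ((integrable_const m).sub hD) hi' fun x => ?_
          have := neg_abs_le (x - m)
          have := habs x
          simp only
          linarith
      _ = s⁻¹ * ∫ x, Real.exp (s * |x - m|) ∂D := integral_const_mul _ _
      _ ≤ _ := by gcongr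
  have h4 : (N : ℝ) * ∫ x, max (x - L) 0 ∂D ≤ s⁻¹ * A := by
    calc (N : ℝ) * ∫ x, max (x - L) 0 ∂D ≤ N * ((N : ℝ)⁻¹ * (s⁻¹ * A)) := by gcongr
      _ = s⁻¹ * A := by field_simp
  have e : (Real.log N + 2 * A) / s = Real.log N / s + s⁻¹ * A + s⁻¹ * A := by
    field_simp; ring
  rw [e]
  linarith

/-- The expected maximum of positive perturbations with a power tail. -/
theorem integral_iSup_sub_le_of_power_tail {f : ℝ → ℝ} (hf : Measurable f)
    [IsProbabilityMeasure (volume.withDensity fun x => ENNReal.ofReal (f x))]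
    (h0 : ∀ x, x ≤ 0 → f x = 0) {N : ℕ} (hN : 1 < Real.log N)
    (hle : ∀ x, 0 < x → f x ≤ Real.log N * x ^ (-Real.log N - 1)) :
    Integrable (fun x => x) (volume.withDensity fun x => ENNReal.ofReal (f x)) ∧
      ∫ v, (⨆ j, v j)
          ∂(Measure.pi fun _ : Fin N => volume.withDensity fun x => ENNReal.ofReal (f x)) -
        ∫ x, x ∂(volume.withDensity fun x => ENNReal.ofReal (f x)) ≤
        Real.exp 1 * (1 + Real.log N / (Real.log N - 1)) := by
  have hN0 : (0 : ℝ) < N := by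
    rcases Nat.eq_zero_or_pos N with rfl | h
    · simp at hN; linarith
    · exact_mod_cast h
  have hN1 : 1 ≤ N := by exact_mod_cast hN0
  set α := Real.log N with hα
  set L := Real.exp 1 with hL
  have hL0 : 0 < L := Real.exp_pos 1
  set D := volume.withDensity fun x => ENNReal.ofReal (f x) with hD
  have hA : 0 ≤ (N : ℝ)⁻¹ * (L * (α / (α - 1))) := by
    have : 0 < α - 1 := by linarith
    positivity
  have hlin : ∫⁻ x, ENNReal.ofReal (max (x - L) 0) ∂D ≤
      ENNReal.ofReal ((N : ℝ)⁻¹ * (L * (α / (α - 1)))) := by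
    rw [hD, lintegral_withDensity_eq_lintegral_mul _ (by fun_prop) (by fun_prop)]
    calc _ ≤ ∫⁻ x, (Ioi L).indicator (fun x => ENNReal.ofReal (α * x ^ (-α))) x := by
          refine lintegral_mono fun x => ?_
          simp only [Pi.mul_apply]
          by_cases hx : L < x
          · have hx0 : 0 < x := hL0.trans hx
            rw [indicator_of_mem (show x ∈ Ioi L from hx), ← ENNReal.ofReal_mul' (le_max_right _ _)]
            refine ENNReal.ofReal_le_ofReal ?_
            rw [max_eq_left (by linarith)]
            calc f x * (x - L) ≤ α * x ^ (-α - 1) * x := by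
                  refine mul_le_mul (hle x hx0) (by linarith) (by linarith) (by positivity)
              _ = α * x ^ (-α) := by
                  rw [mul_assoc, ← Real.rpow_add_one hx0.ne']; ring_nf
          · rw [max_eq_right (by linarith)]
            simp
      _ = ∫⁻ x in Ioi L, ENNReal.ofReal (α * x ^ (-α)) := lintegral_indicator measurableSet_Ioi _
      _ = ENNReal.ofReal (α / (α - 1) * L ^ (1 - α)) := by
          refine lintegral_Ioi_eq_of_hasDerivAt_neg (S := fun x => α / (α - 1) * x ^ (1 - α))
            (fun x hx => ?_) (fun x hx => ?_) ?_
          · have hx0 : 0 < x := hL0.trans_le hx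
            have h := (Real.hasDerivAt_rpow_const (p := 1 - α) (Or.inl hx0.ne')).const_mul
              (α / (α - 1))
            refine h.congr_deriv ?_
            have : α - 1 ≠ 0 := by linarith
            rw [show 1 - α - 1 = -α by ring]
            field_simp
            ring
          · have hx0 : 0 < x := hL0.trans hx
            positivity
          · have h := (tendsto_rpow_neg_atTop (y := α - 1) (by linarith)).const_mul (α / (α - 1))
            simpa using h
      _ ≤ _ := by
          refine ENNReal.ofReal_le_ofReal (le_of_eq ?_)
          rw [hL, ← Real.exp_mul, one_mul, sub_eq_add_neg 1 α, Real.exp_add, Real.exp_neg, hα,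
            Real.exp_log hN0]
          ring
  obtain ⟨hi, hint⟩ := integrable_of_lintegral_ofReal_le (by fun_prop)
    (fun x => le_max_right _ _) hA hlin
  have hpos : ∀ᵐ x ∂D, 0 ≤ x := by
    have : D (Iio 0) = 0 := by
      rw [hD, withDensity_apply _ measurableSet_Iio]
      refine (setLIntegral_congr_fun measurableSet_Iio (g := fun _ => 0) fun x hx => ?_).trans
        (by simp)
      simp [h0 x (le_of_lt hx)]
    filter_upwards [measure_eq_zero_iff_ae_notMem.1 this] with x hx
    exact not_lt.1 hx
  have hDi : Integrable (fun x => x) D := by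
    refine (hi.add (integrable_const L)).mono' (by fun_prop) ?_
    filter_upwards [hpos] with x hx
    rw [Real.norm_eq_abs, abs_of_nonneg hx]
    have := le_max_left (x - L) 0
    simp only [Pi.add_apply]
    linarith
  refine ⟨hDi, ?_⟩
  have h1 := integral_iSup_le hN1 hDi L
  have h2 : 0 ≤ ∫ x, x ∂D := integral_nonneg_of_ae hpos
  have h3 : (N : ℝ) * ∫ x, max (x - L) 0 ∂D ≤ L * (α / (α - 1)) := by
    calc (N : ℝ) * ∫ x, max (x - L) 0 ∂D ≤ N * ((N : ℝ)⁻¹ * (L * (α / (α - 1)))) := by gcongr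
      _ = _ := by field_simp
  linarith

theorem conditioned_withDensity {f : ℝ → ℝ≥0∞} (hf : Measurable f) :
    conditioned (volume.withDensity f) = volume.withDensity fun x =>
      (volume.withDensity f (Ioi 1))⁻¹ * (Ioi 0).indicator (fun x => f (x + 1)) x := by
  ext s hs
  have hm : Measurable fun x : ℝ => x - 1 := by fun_prop
  have hfm : Measurable fun x => f (x + 1) := by fun_prop
  rw [conditioned, Measure.map_apply hm hs, cond_apply measurableSet_Ioi,
    withDensity_apply _ (measurableSet_Ioi.inter (hm hs)), withDensity_apply _ hs,
    lintegral_const_mul _ (hfm.indicator measurableSet_Ioi),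
    setLIntegral_indicator measurableSet_Ioi,
    ← lintegral_indicator (measurableSet_Ioi.inter (hm hs)),
    ← lintegral_indicator (measurableSet_Ioi.inter hs),
    ← lintegral_add_right_eq_self _ (1 : ℝ)]
  congr 2
  ext x
  have : x + 1 ∈ Ioi 1 ∩ (fun x => x - 1) ⁻¹' s ↔ x ∈ Ioi 0 ∩ s := by simp
  by_cases hx : x ∈ Ioi 0 ∩ s
  · rw [indicator_of_mem hx, indicator_of_mem (this.2 hx)]
  · rw [indicator_of_notMem hx, indicator_of_notMem (mt this.1 hx)]

/-! ### The Gumbel distribution -/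

theorem measurable_gumbelPDFReal (μ β : ℝ) : Measurable (gumbelPDFReal μ β) := by
  unfold gumbelPDFReal; fun_prop

theorem mul_exp_neg_le_one_sub (u : ℝ) : u * Real.exp (-u) ≤ 1 - Real.exp (-u) := by
  have h := mul_le_mul_of_nonneg_right (Real.add_one_le_exp u) (Real.exp_pos (-u)).le
  rw [← Real.exp_add, add_neg_cancel, Real.exp_zero] at h
  linarith

theorem sq_mul_exp_neg_le {u : ℝ} (hu : 0 ≤ u) :
    u ^ 2 * Real.exp (-u) ≤ 2 * (1 - Real.exp (-u)) := by
  have h := mul_le_mul_of_nonneg_right (Real.quadratic_le_exp_of_nonneg hu) (Real.exp_pos (-u)).le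
  rw [← Real.exp_add, add_neg_cancel, Real.exp_zero] at h
  have := mul_nonneg hu (Real.exp_pos (-u)).le
  linarith

theorem gumbelMeasure_Ioi (μ y : ℝ) : gumbelMeasure μ 1 (Ioi y) =
    ENNReal.ofReal (1 - Real.exp (-Real.exp (-(y - μ)))) := by
  rw [gumbelMeasure, withDensity_apply _ measurableSet_Ioi]
  refine lintegral_Ioi_eq_of_hasDerivAt_neg
    (S := fun x => 1 - Real.exp (-Real.exp (-(x - μ)))) (fun x _ => ?_) (fun x _ => ?_) ?_
  · have h1 : HasDerivAt (fun x : ℝ => x - μ) 1 x := (hasDerivAt_id x).sub_const μ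
    refine (((h1.fun_neg.exp.fun_neg).exp).const_sub 1).congr_deriv ?_
    simp only [gumbelPDFReal, div_one, inv_one]
    ring
  · rw [gumbelPDFReal]; positivity
  · have ha : Tendsto (fun x : ℝ => x - μ) atTop atTop :=
      tendsto_atTop_add_const_right _ (-μ) tendsto_id
    have := ((Real.continuous_exp.tendsto _).comp
      (Real.tendsto_exp_neg_atTop_nhds_zero.comp ha).neg).const_sub 1
    simpa [Function.comp_def] using this

theorem hazardRateLE_gumbelMeasure (μ : ℝ) : HazardRateLE (gumbelMeasure μ 1) 1 := by
  have := isProbabilityMeasure_gumbelMeasure μ one_pos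
  unfold gumbelMeasure at this
  refine hazardRateLE_withDensity zero_le_one fun y => ?_
  have h := gumbelMeasure_Ioi μ y
  unfold gumbelMeasure at h
  rw [h, ENNReal.ofReal_one, one_mul]
  refine ENNReal.ofReal_le_ofReal ?_
  simpa [gumbelPDFReal] using mul_exp_neg_le_one_sub (Real.exp (-(y - μ)))

theorem lintegral_exp_neg_half_abs :
    ∫⁻ x : ℝ, ENNReal.ofReal (Real.exp (-(|x| / 2))) ≤ ENNReal.ofReal 4 := by
  have h1 : ∫⁻ x in Ioi (0 : ℝ), ENNReal.ofReal (Real.exp (-(|x| / 2))) = ENNReal.ofReal 2 := by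
    rw [setLIntegral_congr_fun (g := fun x => ENNReal.ofReal (Real.exp (-(x / 2))))
      measurableSet_Ioi fun x hx => by rw [abs_of_pos hx]]
    have h := lintegral_Ioi_eq_of_hasDerivAt_neg (y := 0) (f := fun x => Real.exp (-(x / 2)))
      (S := fun x => 2 * Real.exp (-(x / 2))) (fun x _ => ?_) (fun x _ => (Real.exp_pos _).le) ?_
    · simpa using h
    · have h1 : HasDerivAt (fun x : ℝ => x / 2) (1 / 2) x := (hasDerivAt_id x).div_const 2
      refine (h1.fun_neg.exp.const_mul 2).congr_deriv ?_
      ring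
    · have ha : Tendsto (fun x : ℝ => x / 2) atTop atTop :=
        tendsto_id.atTop_div_const two_pos
      simpa using (Real.tendsto_exp_neg_atTop_nhds_zero.comp ha).const_mul 2
  have h2 : ∫⁻ x in Iio (0 : ℝ), ENNReal.ofReal (Real.exp (-(|x| / 2))) = ENNReal.ofReal 2 := by
    rw [← h1, ← lintegral_indicator measurableSet_Iio, ← lintegral_indicator measurableSet_Ioi,
      ← lintegral_neg_eq_self]
    congr 1
    ext x
    simp [indicator]
  have h3 : ∫⁻ x in Iic (0 : ℝ), ENNReal.ofReal (Real.exp (-(|x| / 2))) = ENNReal.ofReal 2 := by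
    rw [← h2]
    exact (setLIntegral_congr Iio_ae_eq_Iic).symm
  rw [← lintegral_add_compl _ measurableSet_Iic (A := Iic (0 : ℝ)), compl_Iic, h1, h3,
    ← ENNReal.ofReal_add (by norm_num) (by norm_num)]
  norm_num

theorem gumbelPDFReal_le (μ x : ℝ) : gumbelPDFReal μ 1 x ≤ 2 * Real.exp (-|x - μ|) := by
  simp only [gumbelPDFReal, div_one, inv_one, one_mul]
  rcases le_total 0 (x - μ) with h | h
  · rw [abs_of_nonneg h]
    have h1 : Real.exp (-Real.exp (-(x - μ))) ≤ 1 := Real.exp_le_one_iff.2 (by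
      have := Real.exp_pos (-(x - μ)); linarith)
    nlinarith [Real.exp_pos (-(x - μ))]
  · rw [abs_of_nonpos h, neg_neg]
    have hu := Real.exp_pos (-(x - μ))
    have h1 := sq_mul_exp_neg_le hu.le
    have h2 := Real.exp_pos (-Real.exp (-(x - μ)))
    have e : Real.exp (x - μ) = (Real.exp (-(x - μ)))⁻¹ := by rw [Real.exp_neg, inv_inv]
    rw [e, ← div_eq_mul_inv, le_div_iff₀ hu]
    nlinarith

theorem lintegral_exp_gumbelMeasure_le (μ : ℝ) :
    ∫⁻ x, ENNReal.ofReal (Real.exp (1 / 2 * |x - μ|)) ∂(gumbelMeasure μ 1) ≤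
      ENNReal.ofReal 8 := by
  rw [gumbelMeasure, lintegral_withDensity_eq_lintegral_mul _
    (measurable_gumbelPDFReal μ 1).ennreal_ofReal (by fun_prop)]
  calc _ ≤ ∫⁻ x, ENNReal.ofReal 2 * ENNReal.ofReal (Real.exp (-(|x - μ| / 2))) := by
        refine lintegral_mono fun x => ?_
        simp only [Pi.mul_apply]
        rw [← ENNReal.ofReal_mul' (Real.exp_pos _).le, ← ENNReal.ofReal_mul zero_le_two]
        refine ENNReal.ofReal_le_ofReal ?_
        calc gumbelPDFReal μ 1 x * Real.exp (1 / 2 * |x - μ|)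
            ≤ 2 * Real.exp (-|x - μ|) * Real.exp (1 / 2 * |x - μ|) := by
              gcongr; exact gumbelPDFReal_le μ x
          _ = _ := by rw [mul_assoc, ← Real.exp_add]; ring_nf
    _ = ENNReal.ofReal 2 * ∫⁻ x, ENNReal.ofReal (Real.exp (-(|x - μ| / 2))) :=
        lintegral_const_mul' _ _ ENNReal.ofReal_ne_top
    _ = ENNReal.ofReal 2 * ∫⁻ x : ℝ, ENNReal.ofReal (Real.exp (-(|x| / 2))) := by
        rw [lintegral_sub_right_eq_self
          (fun x : ℝ => ENNReal.ofReal (Real.exp (-(|x| / 2)))) μ]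
    _ ≤ ENNReal.ofReal 2 * ENNReal.ofReal 4 := by gcongr; exact lintegral_exp_neg_half_abs
    _ = ENNReal.ofReal 8 := by rw [← ENNReal.ofReal_mul zero_le_two]; norm_num

/-! ### The Gamma distribution -/

theorem hazardRateLE_gammaMeasure {α β : ℝ} (hα : 1 ≤ α) (hβ : 0 < β) :
    HazardRateLE (gammaMeasure α β) β := by
  have := isProbabilityMeasure_gammaMeasure (zero_lt_one.trans_le hα) hβ
  unfold gammaMeasure at this ⊢
  refine hazardRateLE_withDensity hβ.le fun y => ?_
  rcases lt_or_ge y 0 with hy | hy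
  · rw [gammaPDF_of_neg hy]; exact zero_le
  · have hΓ : 0 < Real.Gamma α := Real.Gamma_pos_of_pos (by linarith)
    have h1 := lintegral_Ioi_eq_of_hasDerivAt_neg (y := y)
      (f := fun x => β ^ α / Real.Gamma α * y ^ (α - 1) * Real.exp (-(β * x)))
      (S := fun x => β ^ α / Real.Gamma α * y ^ (α - 1) * (Real.exp (-(β * x)) / β))
      (fun x _ => ?_) (fun x _ => by positivity) ?_
    · rw [gammaPDF_of_nonneg hy, withDensity_apply _ measurableSet_Ioi]
      calc _ = ENNReal.ofReal β * ENNReal.ofReal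
            (β ^ α / Real.Gamma α * y ^ (α - 1) * (Real.exp (-(β * y)) / β)) := by
            rw [← ENNReal.ofReal_mul hβ.le]
            congr 1
            field_simp
        _ ≤ _ := by
            rw [← h1]
            gcongr ENNReal.ofReal β * ?_
            refine setLIntegral_mono' measurableSet_Ioi fun x (hx : y < x) => ?_
            rw [gammaPDF_of_nonneg (hy.trans hx.le)]
            refine ENNReal.ofReal_le_ofReal ?_
            have : y ^ (α - 1) ≤ x ^ (α - 1) := Real.rpow_le_rpow hy hx.le (by linarith)
            gcongr
    · have h1 : HasDerivAt (fun x : ℝ => β * x) β x := by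
        simpa using (hasDerivAt_id x).const_mul β
      refine ((h1.fun_neg.exp.div_const β).const_mul _).congr_deriv ?_
      field_simp
    · have ha : Tendsto (fun x : ℝ => β * x) atTop atTop := tendsto_id.const_mul_atTop hβ
      simpa using ((Real.tendsto_exp_neg_atTop_nhds_zero.comp ha).div_const β).const_mul
        (β ^ α / Real.Gamma α * y ^ (α - 1))

theorem lintegral_exp_gammaMeasure_le {α β : ℝ} (hα : 1 ≤ α) (hβ : 0 < β) :
    ∫⁻ x, ENNReal.ofReal (Real.exp (β / 2 * |x - 0|)) ∂(gammaMeasure α β) ≤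
      ENNReal.ofReal (2 ^ α) := by
  have hα0 : 0 < α := by linarith
  have hm : Measurable (gammaPDF α β) := (measurable_gammaPDFReal α β).ennreal_ofReal
  unfold gammaMeasure
  rw [lintegral_withDensity_eq_lintegral_mul _ hm (by fun_prop)]
  calc _ = ∫⁻ x, ENNReal.ofReal (2 ^ α) * gammaPDF α (β / 2) x := by
        refine lintegral_congr fun x => ?_
        simp only [Pi.mul_apply]
        rcases lt_or_ge x 0 with hx | hx
        · rw [gammaPDF_of_neg hx, gammaPDF_of_neg hx]; simp
        · rw [gammaPDF_of_nonneg hx, gammaPDF_of_nonneg hx,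
            ← ENNReal.ofReal_mul' (Real.exp_pos _).le, ← ENNReal.ofReal_mul (by positivity)]
          congr 1
          have e : Real.exp (-(β / 2 * x)) =
              Real.exp (-(β * x)) * Real.exp (β / 2 * |x - 0|) := by
            rw [sub_zero, abs_of_nonneg hx, ← Real.exp_add]; ring_nf
          rw [e, Real.div_rpow hβ.le zero_le_two]
          have : (2 : ℝ) ^ α ≠ 0 := by positivity
          field_simp
    _ = ENNReal.ofReal (2 ^ α) := by
        rw [lintegral_const_mul' _ _ ENNReal.ofReal_ne_top,
          lintegral_gammaPDF_eq_one hα0 (by positivity), mul_one]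
    _ ≤ _ := le_rfl

/-! ### The Fréchet distribution -/

theorem measurable_frechetPDFReal (α : ℝ) : Measurable (frechetPDFReal α) :=
  Measurable.ite measurableSet_Ioi (by fun_prop) measurable_const

theorem hazardRateLE_frechetMeasure {α : ℝ} (hα : 1 ≤ α) :
    HazardRateLE (frechetMeasure α) (2 * α) := by
  have := isProbabilityMeasure_frechetMeasure (zero_lt_one.trans_le hα)
  unfold frechetMeasure at this ⊢
  refine hazardRateLE_withDensity (by linarith) fun y => ?_
  rcases le_or_gt y 0 with hy | hy
  · rw [frechetPDFReal, if_neg (not_lt.2 hy), ENNReal.ofReal_zero]; exact zero_le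
  · have h1 := lintegral_Ioi_eq_of_hasDerivAt_neg (y := y) (f := frechetPDFReal α)
      (S := fun x => 1 - Real.exp (-x ^ (-α))) (fun x hx => ?_) (fun x hx => ?_) ?_
    · rw [withDensity_apply _ measurableSet_Ioi, h1, ← ENNReal.ofReal_mul (by linarith)]
      refine ENNReal.ofReal_le_ofReal ?_
      rw [frechetPDFReal, if_pos hy, Real.rpow_sub_one hy.ne']
      have hv : 0 ≤ y ^ (-α) := by positivity
      have he := (Real.exp_pos (-y ^ (-α))).le
      have b1 := mul_exp_neg_le_one_sub (y ^ (-α))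
      have b2 := sq_mul_exp_neg_le hv
      have key : y ^ (-α) / y * Real.exp (-y ^ (-α)) ≤ 2 * (1 - Real.exp (-y ^ (-α))) := by
        rcases le_total 1 y with h | h
        · have : y ^ (-α) / y ≤ y ^ (-α) := div_le_self hv h
          nlinarith
        · have h2 : y⁻¹ ≤ y ^ (-α) := by
            rw [← Real.rpow_neg_one]
            exact Real.rpow_le_rpow_of_exponent_ge hy h (by linarith)
          have : y ^ (-α) / y ≤ (y ^ (-α)) ^ 2 := by
            rw [div_eq_mul_inv, sq]; gcongr
          nlinarith
      calc α * (y ^ (-α) / y) * Real.exp (-y ^ (-α))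
          = α * (y ^ (-α) / y * Real.exp (-y ^ (-α))) := by ring
        _ ≤ α * (2 * (1 - Real.exp (-y ^ (-α)))) := by gcongr
        _ = _ := by ring
    · have hx0 : 0 < x := hy.trans_le hx
      have h := ((Real.hasDerivAt_rpow_const (p := -α) (Or.inl hx0.ne')).fun_neg).exp.const_sub 1
      refine h.congr_deriv ?_
      rw [frechetPDFReal, if_pos hx0]
      ring
    · have hx0 : 0 < x := hy.trans hx
      rw [frechetPDFReal, if_pos hx0]
      positivity
    · have h2 := ((Real.continuous_exp.tendsto _).comp
        (tendsto_rpow_neg_atTop (y := α) (by linarith)).neg).const_sub 1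
      simpa [Function.comp_def] using h2

theorem frechetPDFReal_le {α x : ℝ} (hα : 0 ≤ α) (hx : 0 < x) :
    frechetPDFReal α x ≤ α * x ^ (-α - 1) := by
  rw [frechetPDFReal, if_pos hx]
  refine mul_le_of_le_one_right (by positivity) (Real.exp_le_one_iff.2 ?_)
  have : 0 ≤ x ^ (-α) := by positivity
  linarith

/-! ### The conditioned Pareto and Weibull distributions -/

/-- The density of the law of `X - 1` where `X` has a Pareto distribution of scale `1`. -/
noncomputable def lomaxPDFReal (α x : ℝ) : ℝ :=
  if 0 < x then α * (x + 1) ^ (-α - 1) else 0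

theorem measurable_lomaxPDFReal (α : ℝ) : Measurable (lomaxPDFReal α) :=
  Measurable.ite measurableSet_Ioi (by fun_prop) measurable_const

theorem lintegral_lomax_Ioi {α y : ℝ} (hα : 0 < α) (hy : 0 ≤ y) :
    ∫⁻ x in Ioi y, ENNReal.ofReal (α * (x + 1) ^ (-α - 1)) =
      ENNReal.ofReal ((y + 1) ^ (-α)) := by
  refine lintegral_Ioi_eq_of_hasDerivAt_neg (S := fun x => (x + 1) ^ (-α)) (fun x hx => ?_)
    (fun x hx => ?_) ?_
  · have hx0 : 0 < x + 1 := by have : y ≤ x := hx; linarith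
    have h1 : HasDerivAt (fun x : ℝ => x + 1) 1 x := (hasDerivAt_id x).add_const 1
    refine (h1.rpow_const (p := -α) (Or.inl hx0.ne')).congr_deriv ?_
    ring
  · have hx0 : 0 < x + 1 := by have : y < x := hx; linarith
    positivity
  · exact (tendsto_rpow_neg_atTop hα).comp (tendsto_atTop_add_const_right _ 1 tendsto_id)

theorem ofReal_lomaxPDFReal (α x : ℝ) : ENNReal.ofReal (lomaxPDFReal α x) =
    (Ioi 0).indicator (fun x => ENNReal.ofReal (α * (x + 1) ^ (-α - 1))) x := by
  by_cases hx : 0 < x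
  · rw [indicator_of_mem (show x ∈ Ioi 0 from hx), lomaxPDFReal, if_pos hx]
  · rw [indicator_of_notMem (show x ∉ Ioi 0 from hx), lomaxPDFReal, if_neg hx,
      ENNReal.ofReal_zero]

theorem lintegral_lomaxPDFReal {α : ℝ} (hα : 0 < α) :
    ∫⁻ x, ENNReal.ofReal (lomaxPDFReal α x) = 1 := by
  rw [lintegral_congr (ofReal_lomaxPDFReal α), lintegral_indicator measurableSet_Ioi,
    lintegral_lomax_Ioi hα le_rfl, zero_add, Real.one_rpow, ENNReal.ofReal_one]

theorem isProbabilityMeasure_lomax {α : ℝ} (hα : 0 < α) :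
    IsProbabilityMeasure (volume.withDensity fun x => ENNReal.ofReal (lomaxPDFReal α x)) := by
  refine ⟨?_⟩
  rw [withDensity_apply _ MeasurableSet.univ, setLIntegral_univ, lintegral_lomaxPDFReal hα]

theorem conditioned_paretoMeasure {α : ℝ} (hα : 0 < α) :
    conditioned (paretoMeasure 1 α) =
      volume.withDensity fun x => ENNReal.ofReal (lomaxPDFReal α x) := by
  have hm : Measurable (paretoPDF 1 α) := (measurable_paretoPDFReal 1 α).ennreal_ofReal
  have e : ∀ x, (Ioi (0 : ℝ)).indicator (fun x => paretoPDF 1 α (x + 1)) x =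
      ENNReal.ofReal (lomaxPDFReal α x) := fun x => by
    rw [ofReal_lomaxPDFReal]
    by_cases hx : 0 < x
    · rw [indicator_of_mem (show x ∈ Ioi 0 from hx), indicator_of_mem (show x ∈ Ioi 0 from hx),
        paretoPDF_of_le (by linarith), Real.one_rpow, mul_one, neg_add']
    · rw [indicator_of_notMem (show x ∉ Ioi 0 from hx),
        indicator_of_notMem (show x ∉ Ioi 0 from hx)]
  have h1 : volume.withDensity (paretoPDF 1 α) (Ioi 1) = 1 := by
    rw [withDensity_apply _ measurableSet_Ioi, ← lintegral_indicator measurableSet_Ioi,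
      ← lintegral_add_right_eq_self _ (1 : ℝ), ← lintegral_lomaxPDFReal hα,
      ← lintegral_congr e]
    refine lintegral_congr fun x => ?_
    by_cases hx : 0 < x
    · rw [indicator_of_mem (show x ∈ Ioi 0 from hx),
        indicator_of_mem (show x + 1 ∈ Ioi 1 by simpa using hx)]
    · rw [indicator_of_notMem (show x ∉ Ioi 0 from hx),
        indicator_of_notMem (show x + 1 ∉ Ioi 1 by simpa using hx)]
  unfold paretoMeasure
  rw [conditioned_withDensity hm, h1]
  simp only [inv_one, one_mul, e]

theorem hazardRateLE_lomax {α : ℝ} (hα : 0 < α) :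
    HazardRateLE (volume.withDensity fun x => ENNReal.ofReal (lomaxPDFReal α x)) α := by
  have := isProbabilityMeasure_lomax hα
  refine hazardRateLE_withDensity hα.le fun y => ?_
  rcases le_or_gt y 0 with hy | hy
  · rw [lomaxPDFReal, if_neg (not_lt.2 hy), ENNReal.ofReal_zero]; exact zero_le
  · rw [withDensity_apply _ measurableSet_Ioi,
      setLIntegral_congr_fun (g := fun x => ENNReal.ofReal (α * (x + 1) ^ (-α - 1)))
        measurableSet_Ioi (fun x hx => by rw [lomaxPDFReal, if_pos (hy.trans hx)]),
      lintegral_lomax_Ioi hα hy.le, ← ENNReal.ofReal_mul hα.le, lomaxPDFReal, if_pos hy]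
    gcongr
    · linarith
    · linarith

theorem lomaxPDFReal_le {α x : ℝ} (hα : 0 ≤ α) (hx : 0 < x) :
    lomaxPDFReal α x ≤ α * x ^ (-α - 1) := by
  rw [lomaxPDFReal, if_pos hx]
  refine mul_le_mul_of_nonneg_left ?_ hα
  exact Real.rpow_le_rpow_of_nonpos hx (by linarith) (by linarith)

theorem conditioned_weibullMeasure : conditioned (weibullMeasure 1 1) = gammaMeasure 1 1 := by
  have hw : ∀ x, 0 < x → weibullPDFReal 1 1 x = Real.exp (-x) := fun x hx => by
    rw [weibullPDFReal, if_pos hx]; simp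
  have hm : Measurable (weibullPDFReal 1 1) :=
    Measurable.ite measurableSet_Ioi (by fun_prop) measurable_const
  unfold weibullMeasure gammaMeasure
  have h1 : volume.withDensity (fun x => ENNReal.ofReal (weibullPDFReal 1 1 x)) (Ioi 1) =
      ENNReal.ofReal (Real.exp (-1)) := by
    rw [withDensity_apply _ measurableSet_Ioi,
      setLIntegral_congr_fun (g := fun x => ENNReal.ofReal (Real.exp (-x)))
        measurableSet_Ioi (fun x hx => by rw [hw x (one_pos.trans hx)])]
    refine lintegral_Ioi_eq_of_hasDerivAt_neg (S := fun x => Real.exp (-x)) (fun x _ => ?_)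
      (fun x _ => (Real.exp_pos _).le) Real.tendsto_exp_neg_atTop_nhds_zero
    simpa using (hasDerivAt_neg x).exp
  rw [conditioned_withDensity hm.ennreal_ofReal, h1]
  refine withDensity_congr_ae ?_
  have h0 : ∀ᵐ x : ℝ, x ≠ 0 := by simp [ae_iff]
  filter_upwards [h0] with x hx0
  rcases lt_or_gt_of_ne hx0 with hx | hx
  · rw [indicator_of_notMem (show x ∉ Ioi 0 from not_lt.2 hx.le), gammaPDF_of_neg hx, mul_zero]
  · rw [indicator_of_mem (show x ∈ Ioi 0 from hx), gammaPDF_of_nonneg hx.le, hw _ (by linarith),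
      ← ENNReal.ofReal_inv_of_pos (Real.exp_pos _), ← ENNReal.ofReal_mul (by positivity),
      ← Real.exp_neg, ← Real.exp_add]
    simp

/-! ### The choice of the scale -/

theorem ExpectedRegretAtMost.mono.{u} {D : Measure ℝ} {η : ℝ} {N T M : ℕ} {B B' : ℝ}
    (h : ExpectedRegretAtMost.{u} D η N T M B) (hB : B ≤ B') :
    ExpectedRegretAtMost.{u} D η N T M B' :=
  fun Ω _ P _ Z hZ sel hsel g hg =>
    ⟨(h Ω P Z hZ sel hsel g hg).1, (h Ω P Z hZ sel hsel g hg).2.trans hB⟩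

theorem one_le_and_mul_div_le {N T M : ℕ} (hN : 2 ≤ N) (hT : 1 ≤ T)
    (hM : ⌊Real.sqrt (N * T)⌋₊ ≤ M) :
    1 ≤ M ∧ (T : ℝ) * (N / M) ≤ 2 * Real.sqrt (N * T) := by
  have hN' : (2 : ℝ) ≤ N := by exact_mod_cast hN
  have hT' : (1 : ℝ) ≤ T := by exact_mod_cast hT
  have hNT : (1 : ℝ) ≤ N * T := by nlinarith
  have h1 : 1 ≤ Real.sqrt (N * T) := Real.one_le_sqrt.2 hNT
  have hf : 1 ≤ ⌊Real.sqrt (N * T)⌋₊ := Nat.le_floor (by simpa using h1)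
  have hM1 : 1 ≤ M := hf.trans hM
  refine ⟨hM1, ?_⟩
  have h2 := Nat.lt_floor_add_one (Real.sqrt (N * T))
  have h3 : (⌊Real.sqrt (N * T)⌋₊ : ℝ) ≤ M := by exact_mod_cast hM
  have h4 : (1 : ℝ) ≤ M := by exact_mod_cast hM1
  have h5 : Real.sqrt (N * T) ≤ 2 * M := by linarith
  rw [← mul_div_assoc, div_le_iff₀ (by linarith)]
  calc (T : ℝ) * N = Real.sqrt (N * T) * Real.sqrt (N * T) := by
        rw [Real.mul_self_sqrt (by linarith)]; ring
    _ ≤ Real.sqrt (N * T) * (2 * M) := by gcongr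
    _ = _ := by ring

theorem expectedRegretAtMost_of_exp_moment {D : Measure ℝ} [IsProbabilityMeasure D]
    {β m A : ℝ} (hβ : 0 < β) (hA : 0 ≤ A) (hD : HazardRateLE D β)
    (h : ∫⁻ x, ENNReal.ofReal (Real.exp (β / 2 * |x - m|)) ∂D ≤ ENNReal.ofReal A)
    {N T M : ℕ} (hN : 2 ≤ N) (hT : 1 ≤ T) (hM : ⌊Real.sqrt (N * T)⌋₊ ≤ M) :
    ExpectedRegretAtMost D (β * Real.sqrt (N * T / Real.log N)) N T M
      ((8 + 8 * A) * Real.sqrt (T * N * Real.log N)) := by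
  have hN' : (2 : ℝ) ≤ N := by exact_mod_cast hN
  have hT' : (1 : ℝ) ≤ T := by exact_mod_cast hT
  have hNT : (0 : ℝ) < N * T := by positivity
  have hl : 1 / 2 ≤ Real.log N := by
    have h1 := Real.log_le_log two_pos hN'
    have h2 := Real.log_two_gt_d9
    linarith
  have hl0 : 0 < Real.log N := by linarith
  obtain ⟨hM1, hMle⟩ := one_le_and_mul_div_le hN hT hM
  set ℓ := Real.log N
  set r := Real.sqrt (N * T / ℓ) with hr
  have hr0 : 0 < r := Real.sqrt_pos.2 (by positivity)
  have hr2 : r * r * ℓ = N * T := by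
    rw [hr, Real.mul_self_sqrt (by positivity)]; field_simp
  have hs : Real.sqrt (T * N * ℓ) = r * ℓ := by
    rw [show (T : ℝ) * N * ℓ = (r * ℓ) ^ 2 by rw [mul_comm (T : ℝ), ← hr2]; ring,
      Real.sqrt_sq (by positivity)]
  obtain ⟨hi, hB⟩ := integral_iSup_sub_le_of_exp_moment (half_pos hβ) hA h
    (show 1 ≤ N by omega)
  refine (expectedRegretAtMost_of_hazardRateLE (mul_pos hβ hr0) hβ.le hD hi (by omega) hM1 T
    hB).mono ?_
  rw [hs]
  have e1 : β * r * ((ℓ + 2 * A) / (β / 2)) = 2 * (r * ℓ) + 4 * (r * A) := by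
    field_simp; ring
  have e2 : (T : ℝ) * (2 * N * (β / (β * r))) = 2 * (r * ℓ) := by
    rw [show (T : ℝ) * (2 * N * (β / (β * r))) = 2 * (N * T) / r by field_simp, ← hr2]
    field_simp
  have e3 : Real.sqrt (N * T) ≤ 2 * (r * ℓ) := by
    rw [← hr2]
    refine Real.sqrt_le_iff.2 ⟨by positivity, ?_⟩
    have : 0 ≤ r * r * ℓ := by positivity
    nlinarith
  have e4 : r * A ≤ 2 * (r * ℓ) * A := by
    have : 0 ≤ r * A := by positivity
    nlinarith
  rw [mul_add (T : ℝ), e1, e2]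
  linarith

theorem one_lt_log_three : 1 < Real.log 3 := by
  rw [Real.lt_log_iff_exp_lt (by norm_num)]
  have := Real.exp_one_lt_d9
  linarith

theorem log_three_le_log {N : ℕ} (hN : 3 ≤ N) : Real.log 3 ≤ Real.log N :=
  Real.log_le_log (by norm_num) (by exact_mod_cast hN)

theorem expectedRegretAtMost_of_power_tail {f : ℝ → ℝ} (hf : Measurable f)
    [IsProbabilityMeasure (volume.withDensity fun x => ENNReal.ofReal (f x))]
    (h0 : ∀ x, x ≤ 0 → f x = 0) {N T M : ℕ} {H : ℝ} (hN : 3 ≤ N) (hT : 1 ≤ T)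
    (hM : ⌊Real.sqrt (N * T)⌋₊ ≤ M)
    (hle : ∀ x, 0 < x → f x ≤ Real.log N * x ^ (-Real.log N - 1))
    (hD : HazardRateLE (volume.withDensity fun x => ENNReal.ofReal (f x)) H)
    (hH0 : 0 ≤ H) (hH : H ≤ 2 * Real.log N) :
    ExpectedRegretAtMost (volume.withDensity fun x => ENNReal.ofReal (f x))
      (Real.sqrt (N * T * Real.log N)) N T M
      ((Real.exp 1 * (2 + 1 / (Real.log 3 - 1)) + 6) * Real.sqrt (T * N * Real.log N)) := by
  have hl3 := one_lt_log_three
  have hl := log_three_le_log hN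
  have hN' : (3 : ℝ) ≤ N := by exact_mod_cast hN
  have hT' : (1 : ℝ) ≤ T := by exact_mod_cast hT
  have hl0 : 0 < Real.log N := by linarith
  obtain ⟨hM1, hMle⟩ := one_le_and_mul_div_le (by omega) hT hM
  obtain ⟨hi, hB⟩ := integral_iSup_sub_le_of_power_tail hf h0 (hl3.trans_le hl) hle
  rw [mul_comm (T : ℝ) N]
  have hs0 : 0 < Real.sqrt (N * T * Real.log N) := Real.sqrt_pos.2 (by positivity)
  have hs2 : Real.sqrt (N * T * Real.log N) * Real.sqrt (N * T * Real.log N) =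
    N * T * Real.log N := Real.mul_self_sqrt (by positivity)
  have hsle : Real.sqrt (N * T) ≤ Real.sqrt (N * T * Real.log N) :=
    Real.sqrt_le_sqrt (le_mul_of_one_le_right (by positivity) (by linarith))
  refine (expectedRegretAtMost_of_hazardRateLE hs0 hH0 hD hi (by omega) hM1 T hB).mono ?_
  set s := Real.sqrt (N * T * Real.log N)
  have e1 : Real.log N / (Real.log N - 1) ≤ 1 + 1 / (Real.log 3 - 1) := by
    have e : Real.log N / (Real.log N - 1) = 1 + 1 / (Real.log N - 1) := by
      have : Real.log N - 1 ≠ 0 := by linarith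
      field_simp
      ring
    rw [e]
    gcongr
  have e2 : (T : ℝ) * (2 * N * (H / s)) ≤ 4 * s := by
    calc (T : ℝ) * (2 * N * (H / s)) ≤ T * (2 * N * (2 * Real.log N / s)) := by gcongr
      _ = 4 * (N * T * Real.log N) / s := by ring
      _ = 4 * s := by rw [← hs2]; field_simp
  have e3 : s * (Real.exp 1 * (1 + Real.log N / (Real.log N - 1))) ≤
      s * (Real.exp 1 * (2 + 1 / (Real.log 3 - 1))) := by
    have : 1 + Real.log N / (Real.log N - 1) ≤ 2 + 1 / (Real.log 3 - 1) := by linarith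
    gcongr
  rw [mul_add (T : ℝ)]
  linarith

theorem expectedRegretAtMost_gammaMeasure {α β : ℝ} (hα : 1 ≤ α) (hβ : 0 < β) {N T M : ℕ}
    (hN : 2 ≤ N) (hT : 1 ≤ T) (hM : ⌊Real.sqrt (N * T)⌋₊ ≤ M) :
    ExpectedRegretAtMost (gammaMeasure α β) (β * Real.sqrt (N * T / Real.log N)) N T M
      ((8 + 8 * 2 ^ α) * Real.sqrt (T * N * Real.log N)) := by
  have := isProbabilityMeasure_gammaMeasure (zero_lt_one.trans_le hα) hβ
  exact expectedRegretAtMost_of_exp_moment hβ (by positivity)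
    (hazardRateLE_gammaMeasure hα hβ) (lintegral_exp_gammaMeasure_le hα hβ) hN hT hM

end FTPL

theorem mainTheorem5 :
    -- Gumbel with scale 1
    (∃ C : ℝ, ∀ (μ : ℝ) (N T M : ℕ), 2 ≤ N → 1 ≤ T → ⌊Real.sqrt (N * T)⌋₊ ≤ M →
      FTPL.ExpectedRegretAtMost (FTPL.gumbelMeasure μ 1) (Real.sqrt (N * T / Real.log N)) N T M
        (C * Real.sqrt (T * N * Real.log N))) ∧
    -- Frechet with shape log N
    (∃ C : ℝ, ∀ N T M : ℕ, 3 ≤ N → 1 ≤ T → ⌊Real.sqrt (N * T)⌋₊ ≤ M →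
      FTPL.ExpectedRegretAtMost (FTPL.frechetMeasure (Real.log N))
        (Real.sqrt (N * T * Real.log N)) N T M (C * Real.sqrt (T * N * Real.log N))) ∧
    -- modified Weibull with scale 1 and shape 1
    (∃ C : ℝ, ∀ N T M : ℕ, 2 ≤ N → 1 ≤ T → ⌊Real.sqrt (N * T)⌋₊ ≤ M →
      FTPL.ExpectedRegretAtMost (FTPL.conditioned (FTPL.weibullMeasure 1 1))
        (Real.sqrt (N * T / Real.log N)) N T M (C * Real.sqrt (T * N * Real.log N))) ∧
    -- modified Pareto with scale 1 and shape log N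
    (∃ C : ℝ, ∀ N T M : ℕ, 3 ≤ N → 1 ≤ T → ⌊Real.sqrt (N * T)⌋₊ ≤ M →
      FTPL.ExpectedRegretAtMost
        (FTPL.conditioned (ProbabilityTheory.paretoMeasure 1 (Real.log N)))
        (Real.sqrt (N * T * Real.log N)) N T M (C * Real.sqrt (T * N * Real.log N))) ∧
    -- Gamma with shape at least 1; the case of shape and rate 1 is the exponential distribution
    (∀ α : ℝ, 1 ≤ α → ∃ C : ℝ, ∀ (β : ℝ) (N T M : ℕ), 0 < β → 2 ≤ N → 1 ≤ T →
      ⌊Real.sqrt (N * T)⌋₊ ≤ M →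
      FTPL.ExpectedRegretAtMost (ProbabilityTheory.gammaMeasure α β)
        (β * Real.sqrt (N * T / Real.log N)) N T M (C * Real.sqrt (T * N * Real.log N))) := by
  refine ⟨⟨8 + 8 * 8, fun μ N T M hN hT hM => ?_⟩,
    ⟨Real.exp 1 * (2 + 1 / (Real.log 3 - 1)) + 6, fun N T M hN hT hM => ?_⟩,
    ⟨8 + 8 * 2 ^ (1 : ℝ), fun N T M hN hT hM => ?_⟩,
    ⟨Real.exp 1 * (2 + 1 / (Real.log 3 - 1)) + 6, fun N T M hN hT hM => ?_⟩,
    fun α hα => ⟨8 + 8 * 2 ^ α, fun β N T M hβ hN hT hM =>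
      FTPL.expectedRegretAtMost_gammaMeasure hα hβ hN hT hM⟩⟩
  · have := FTPL.isProbabilityMeasure_gumbelMeasure μ one_pos
    simpa only [one_mul] using FTPL.expectedRegretAtMost_of_exp_moment one_pos (by norm_num)
      (FTPL.hazardRateLE_gumbelMeasure μ) (FTPL.lintegral_exp_gumbelMeasure_le μ) hN hT hM
  · have hl : 1 < Real.log N := FTPL.one_lt_log_three.trans_le (FTPL.log_three_le_log hN)
    have := FTPL.isProbabilityMeasure_frechetMeasure (zero_lt_one.trans hl)
    unfold FTPL.frechetMeasure at this ⊢
    exact FTPL.expectedRegretAtMost_of_power_tail (FTPL.measurable_frechetPDFReal _)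
      (fun x hx => if_neg (not_lt.2 hx)) hN hT hM
      (fun x hx => FTPL.frechetPDFReal_le (by linarith) hx)
      (FTPL.hazardRateLE_frechetMeasure hl.le) (by linarith) le_rfl
  · rw [FTPL.conditioned_weibullMeasure]
    simpa only [one_mul] using FTPL.expectedRegretAtMost_gammaMeasure le_rfl one_pos hN hT hM
  · have hl : 1 < Real.log N := FTPL.one_lt_log_three.trans_le (FTPL.log_three_le_log hN)
    have hl0 := zero_lt_one.trans hl
    have := FTPL.isProbabilityMeasure_lomax hl0
    rw [FTPL.conditioned_paretoMeasure hl0]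
    exact FTPL.expectedRegretAtMost_of_power_tail (FTPL.measurable_lomaxPDFReal _)
      (fun x hx => if_neg (not_lt.2 hx)) hN hT hM
      (fun x hx => FTPL.lomaxPDFReal_le hl0.le hx)
      (FTPL.hazardRateLE_lomax hl0) hl0.le (by linarith)
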